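/- Let $n\ge 6$, $M=\{1,\dots,n\}$ and $M'=\{1',\dots,n'\}$. The Brauer monoid $\mathfrak{B}_n$ consists of all partitions of $M\cup M'$ into two-element subsets; the product $\alpha\beta$ is obtained by identifying each right pin $i'$ of $\alpha$ with the left pin $i$ of $\beta$ and joining two of the remaining pins (the left pins of $\alpha$ and the right pins of $\beta$) whenever they become connected, all closed circles being discarded. For $\alpha\in\mathfrak{B}_n$ write $a\equiv_\alpha b$ if $a\ne b$ and $\{a,b\}\in\alpha$. The rank of $\alpha$ is the number of blocks $\{a,b'\}\in\alpha$ with $a,b\in M$, and $\operatorname{corank}(\alpha)=n-\operatorname{rank}(\alpha)$. An $\mathcal{R}$-cross-section of $\mathfrak{B}_n$ is a subsemigroup that contains exactly one element of every $\mathcal{R}$-class (Green's relation $\mathcal{R}$). An $\mathcal{R}$-cross-section $\Lambda$ is canonical if for every $\alpha\in\Lambda$ there is $k\in\{0,\dots,\lfloor n/2\rfloor\}$ with $\operatorname{corank}(\alpha)=2k$ and $(n-2k+1)'\equiv_\alpha(n-2k+2)',\ \dots,\ (n-1)'\equiv_\alpha n'$. For such $\Lambda$ and $1\le i<j\le n$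 let $\alpha_{i,j}$ be the unique element of $\Lambda$ of corank $2$ with $i\equiv_{\alpha_{i,j}}j$. For $1\le i<j<n-1$ and $1\le l\le\lfloor (n-j)/2\rfloor$ the parameter $\alpha_{i,j}^{(l)}\in S_2$ is $\mathrm{id}$ if $(n-2l+2)\equiv_{\alpha_{i,j}}(n-2l)'$, and $(1,2)$ if $(n-2l+2)\equiv_{\alpha_{i,j}}(n-2l-1)'$; exactly one of the two holds. Let $\mathfrak{A}_n$ be the set of the pairs $(n-3,n-2),(n-5,n-4),\dots$ of positive integers. A canonical $\mathcal{R}$-cross-section is called regular if $\alpha_{i,j}^{(l)}=\mathrm{id}$ for all $i,j,l$ as above, and alternating if, for all $i,j,l$ as above, $\alpha_{i,j}^{(l)}=(1,2)$ when $(i,j)\notin\mathfrak{A}_n$ and $\alpha_{i,j}^{(l)}=\mathrm{id}$ when $(i,j)\in\mathfrak{A}_n$. Theorem. For every $n\ge 6$ there is exactly one regular canonical $\mathcal{R}$-cross-section $\Lambda$ of $\mathfrak{B}_n$ and exactly one alternating canonical $\mathcal{R}$-cross-section $\Gamma$ of $\mathfrak{B}_n$, and $\Lambda$ and $\Gamma$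 are not isomorphic as monoids. -/

import Mathlib

/-! # The Brauer monoid and its `R`-cross-sections -/

/-- The pins of a chip on `n` strands: `Sum.inl i` is the left pin labelled `i + 1` (an element
of `M`), and `Sum.inr i` is the right pin labelled `(i + 1)'` (an element of `M'`). -/
abbrev Pin (n : ℕ) : Type := Fin n ⊕ Fin n

/-- An element of the Brauer monoid: a partition of the `2 n` pins into two-element subsets, given
by the map that sends each pin to the other element of its block. -/
@[ext]
structure Brauer (n : ℕ) where
  /-- The other element of the block of a pin. -/
  partner : Pin n → Pin n
  partner_partner : ∀ p, partner (partner p) = p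
  partner_ne : ∀ p, partner p ≠ p

namespace Brauer

variable {n : ℕ}

/-- The pins of two chips that are put side by side. -/
abbrev TwoChips (n : ℕ) : Type := Pin n ⊕ Pin n

/-- The connections between the pins of two chips put side by side: those inside the first chip,
those inside the second chip, and the identification of every right pin of the first chip with the
corresponding left pin of the second chip. -/
inductive Wire (α β : Brauer n) : TwoChips n → TwoChips n → Prop
  | first (p : Pin n) : Wire α β (Sum.inl p) (Sum.inl (α.partner p))
  | second (p : Pin n) : Wire α β (Sum.inr p) (Sum.inr (β.partner p))
  | glue (i : Fin n) : Wire α β (Sum.inl (Sum.inr i)) (Sum.inr (Sum.inl i))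

/-- Two pins are connected if they are joined by a chain of connections. -/
abbrev Connected (α β : Brauer n) : TwoChips n → TwoChips n → Prop :=
  Relation.EqvGen (Wire α β)

/-- The pins of the composite chip: the left pins of the first chip and the right pins of the
second chip. -/
def outer : Pin n → TwoChips n
  | Sum.inl i => Sum.inl (Sum.inl i)
  | Sum.inr i => Sum.inr (Sum.inr i)

theorem outer_injective : Function.Injective (outer (n := n)) := by
  rintro (i | i) (j | j) h <;> simp_all [outer]

/-- Auxiliary: if `A` and `g` are involutions of a finite type, `A` has no fixed point and `g`
fixes `a`, then the cycle of `g * A` through `a` contains exactly one further fixed point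
of `g`. -/
theorem existsUnique_fixed_sameCycle {D : Type*} [Finite D] (A g : Equiv.Perm D)
    (hA : ∀ x, A (A x) = x) (hg : ∀ x, g (g x) = x) (hne : ∀ x, A x ≠ x) (a : D)
    (ha : g a = a) : ∃! b, b ≠ a ∧ g b = b ∧ (g * A).SameCycle a b := by
  set s : Equiv.Perm D := g * A with hs
  have hAA : A * A = 1 := by ext x; simp [hA]
  have hgg : g * g = 1 := by ext x; simp [hg]
  have hAi : A⁻¹ = A := inv_eq_of_mul_eq_one_left hAA
  have hgi : g⁻¹ = g := inv_eq_of_mul_eq_one_left hgg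
  have hsi : s⁻¹ = A * g := by rw [hs, mul_inv_rev, hAi, hgi]
  have hconj : ∀ k : ℤ, g * s ^ k = s ^ (-k) * g := by
    intro k
    have h1 : g * s * g⁻¹ = s⁻¹ := by
      rw [hsi, hgi, hs, ← mul_assoc, hgg, one_mul]
    have h2 : g * s ^ k * g⁻¹ = s ^ (-k) := by
      rw [← conj_zpow, h1, inv_zpow, zpow_neg]
    rw [← h2, inv_mul_cancel_right]
  have hgk : ∀ k : ℤ, g ((s ^ k) a) = (s ^ (-k)) a := by
    intro k
    have := congrArg (fun f : Equiv.Perm D => f a) (hconj k)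
    simpa [Equiv.Perm.mul_apply, ha] using this
  have hAs : ∀ x, A x = g (s x) := by
    intro x
    simp [hs, Equiv.Perm.mul_apply, hg]
  have hAk : ∀ k : ℤ, A ((s ^ k) a) = (s ^ (-(k + 1))) a := by
    intro k
    rw [hAs, ← hgk, add_comm, zpow_add, zpow_one, Equiv.Perm.mul_apply s (s ^ k)]
  set p : ℕ := Function.minimalPeriod (s • ·) a with hp
  have hper : ∀ k : ℤ, (s ^ k) a = a ↔ (p : ℤ) ∣ k := fun k =>
    MulAction.zpow_smul_eq_iff_minimalPeriod_dvd (a := s) (b := a) (n := k)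
  have heq : ∀ k l : ℤ, (s ^ k) a = (s ^ l) a ↔ (p : ℤ) ∣ k - l := by
    intro k l
    rw [← hper, sub_eq_neg_add, zpow_add, Equiv.Perm.mul_apply, zpow_neg,
      Equiv.Perm.inv_eq_iff_eq]
  have hpos : 0 < p := by
    rcases Nat.eq_zero_or_pos p with h0 | h0
    · exfalso
      have hfin : 0 < orderOf s := orderOf_pos s
      have h1 : ((p : ℕ) : ℤ) ∣ (orderOf s : ℤ) := by
        rw [← hper, zpow_natCast, pow_orderOf_eq_one]; rfl
      rw [h0] at h1
      have h2 : (orderOf s : ℤ) = 0 := zero_dvd_iff.1 (by simpa using h1)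
      omega
    · exact h0
  have hodd : ∀ m : ℕ, p ≠ 2 * m + 1 := by
    intro m hm
    apply hne ((s ^ (m : ℤ)) a)
    rw [hAk, heq]
    exact ⟨-1, by rw [hm]; push_cast; ring⟩
  obtain ⟨m, hm | hm⟩ := Nat.even_or_odd' p
  swap
  · exact absurd hm (hodd m)
  refine ⟨(s ^ (m : ℤ)) a, ⟨?_, ?_, ⟨m, rfl⟩⟩, ?_⟩
  · intro h
    rw [hper] at h
    have := Int.le_of_dvd (by omega) h
    omega
  · rw [hgk, heq]
    exact ⟨-1, by rw [hm]; push_cast; ring⟩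
  · rintro b ⟨hb1, hb2, k, rfl⟩
    rw [hgk, heq] at hb2
    rw [Ne, hper] at hb1
    rw [heq]
    obtain ⟨t, ht⟩ := hb2
    rw [hm] at ht hb1 ⊢
    push_cast at ht hb1 ⊢
    have hk : k = m * (-t) := by linarith
    rcases Int.even_or_odd' t with ⟨u, hu | hu⟩
    · exact absurd ⟨-u, by rw [hk, hu]; ring⟩ hb1
    · exact ⟨-u - 1, by rw [hk, hu]; ring⟩

/-- The involution of the pins of two chips given by the two chips. -/
def chipPerm (α β : Brauer n) : Equiv.Perm (TwoChips n) :=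
  Function.Involutive.toPerm (Sum.map α.partner β.partner) (by
    rintro (p | p) <;> simp [α.partner_partner, β.partner_partner])

/-- The involution of the pins of two chips that exchanges glued pins. -/
def gluePerm (n : ℕ) : Equiv.Perm (TwoChips n) :=
  Function.Involutive.toPerm
    (fun x => match x with
      | Sum.inl (Sum.inl i) => Sum.inl (Sum.inl i)
      | Sum.inl (Sum.inr i) => Sum.inr (Sum.inl i)
      | Sum.inr (Sum.inl i) => Sum.inl (Sum.inr i)
      | Sum.inr (Sum.inr i) => Sum.inr (Sum.inr i))
    (by rintro ((i | i) | (i | i)) <;> rfl)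

theorem chipPerm_inl (α β : Brauer n) (p : Pin n) :
    chipPerm α β (Sum.inl p) = Sum.inl (α.partner p) := rfl

theorem chipPerm_inr (α β : Brauer n) (p : Pin n) :
    chipPerm α β (Sum.inr p) = Sum.inr (β.partner p) := rfl

theorem connected_chipPerm (α β : Brauer n) (x : TwoChips n) :
    Connected α β x (chipPerm α β x) := by
  rcases x with p | p
  · exact .rel _ _ (.first p)
  · exact .rel _ _ (.second p)

theorem connected_gluePerm (α β : Brauer n) (x : TwoChips n) :
    Connected α β x (gluePerm n x) := by
  rcases x with (i | i) | (i | i)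
  · exact .refl _
  · exact .rel _ _ (.glue i)
  · exact .symm _ _ (.rel _ _ (.glue i))
  · exact .refl _

theorem gluePerm_fixed_iff (x : TwoChips n) : gluePerm n x = x ↔ ∃ p, x = outer p := by
  constructor
  · rcases x with (i | i) | (i | i) <;> intro h
    · exact ⟨Sum.inl i, rfl⟩
    · exact absurd h Sum.inr_ne_inl
    · exact absurd h Sum.inl_ne_inr
    · exact ⟨Sum.inr i, rfl⟩
  · rintro ⟨i | i, rfl⟩ <;> rfl

theorem chipPerm_chipPerm (α β : Brauer n) (x : TwoChips n) :
    chipPerm α β (chipPerm α β x) = x := by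
  rcases x with p | p <;> simp [chipPerm_inl, chipPerm_inr, partner_partner]

theorem chipPerm_ne (α β : Brauer n) (x : TwoChips n) : chipPerm α β x ≠ x := by
  rcases x with p | p <;> simp [chipPerm_inl, chipPerm_inr, partner_ne]

theorem gluePerm_gluePerm (x : TwoChips n) : gluePerm n (gluePerm n x) = x := by
  rcases x with (i | i) | (i | i) <;> rfl

theorem connected_outer_iff (α β : Brauer n) (p : Pin n) (x : TwoChips n) :
    Connected α β (outer p) x ↔ (gluePerm n * chipPerm α β).SameCycle (outer p) x := by
  set s := gluePerm n * chipPerm α β with hs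
  have hga : gluePerm n (outer p) = outer p := (gluePerm_fixed_iff _).2 ⟨p, rfl⟩
  constructor
  · have hsA : ∀ x, s (chipPerm α β x) = gluePerm n x := fun x => by
      simp [hs, Equiv.Perm.mul_apply, chipPerm_chipPerm]
    have hconj : ∀ k : ℤ, gluePerm n * s ^ k = s ^ (-k) * gluePerm n := by
      intro k
      have h1 : gluePerm n * s * (gluePerm n)⁻¹ = s⁻¹ := by
        rw [eq_inv_iff_mul_eq_one]
        ext1 x
        have hinv : (gluePerm n)⁻¹ = gluePerm n :=
          inv_eq_of_mul_eq_one_left (by ext1 y; simp [gluePerm_gluePerm])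
        rw [hinv]
        simp [hs, Equiv.Perm.mul_apply, gluePerm_gluePerm, chipPerm_chipPerm]
      have h2 : gluePerm n * s ^ k * (gluePerm n)⁻¹ = s ^ (-k) := by
        rw [← conj_zpow, h1, inv_zpow, zpow_neg]
      rw [← h2, inv_mul_cancel_right]
    have hglue : ∀ x, s.SameCycle (outer p) x → s.SameCycle (outer p) (gluePerm n x) := by
      rintro _ ⟨k, rfl⟩
      refine ⟨-k, ?_⟩
      have := congrArg (fun f : Equiv.Perm _ => f (outer p)) (hconj k)
      simpa [Equiv.Perm.mul_apply, hga] using this.symm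
    have hchip : ∀ x, s.SameCycle (outer p) x → s.SameCycle (outer p) (chipPerm α β x) := by
      intro x hx
      have := hglue x hx
      rw [← hsA] at this
      exact Equiv.Perm.sameCycle_apply_right.1 this
    have key : ∀ x y, Connected α β x y →
        (s.SameCycle (outer p) x ↔ s.SameCycle (outer p) y) := by
      intro x y h
      induction h with
      | rel x y h =>
        cases h with
        | first q =>
          refine ⟨fun h => hchip _ h, fun h => ?_⟩
          have := hchip _ h
          rwa [chipPerm_inl, α.partner_partner] at this
        | second q =>
          refine ⟨fun h => hchip _ h, fun h => ?_⟩
          have := hchip _ h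
          rwa [chipPerm_inr, β.partner_partner] at this
        | glue i => exact ⟨fun h => hglue _ h, fun h => hglue _ h⟩
      | refl x => exact Iff.rfl
      | symm x y _ ih => exact ih.symm
      | trans x y z _ _ ih1 ih2 => exact ih1.trans ih2
    exact fun h => (key _ _ h).1 (Equiv.Perm.SameCycle.refl _ _)
  · intro h
    obtain ⟨k, rfl⟩ := h.exists_nat_pow_eq
    clear h
    induction k with
    | zero => exact .refl _
    | succ k ih =>
      rw [pow_succ', Equiv.Perm.mul_apply, hs, Equiv.Perm.mul_apply]
      exact .trans _ _ _ ih (.trans _ _ _ (connected_chipPerm _ _ _) (connected_gluePerm _ _ _))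

/-- Every outer pin is connected to exactly one other outer pin. -/
theorem existsUnique_connected (α β : Brauer n) (p : Pin n) :
    ∃! q, q ≠ p ∧ Connected α β (outer p) (outer q) := by
  obtain ⟨b, ⟨hb1, hb2, hb3⟩, hb4⟩ := existsUnique_fixed_sameCycle (chipPerm α β) (gluePerm n)
    (chipPerm_chipPerm α β) gluePerm_gluePerm (chipPerm_ne α β) (outer p)
    ((gluePerm_fixed_iff _).2 ⟨p, rfl⟩)
  obtain ⟨q, rfl⟩ := (gluePerm_fixed_iff _).1 hb2
  refine ⟨q, ⟨fun h => hb1 (by rw [h]), (connected_outer_iff _ _ _ _).2 hb3⟩, ?_⟩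
  rintro r ⟨hr1, hr2⟩
  exact outer_injective (hb4 _ ⟨fun h => hr1 (outer_injective h),
    (gluePerm_fixed_iff _).2 ⟨r, rfl⟩, (connected_outer_iff _ _ _ _).1 hr2⟩)

/-- The composition of chips: two pins of the composite chip are joined if and only if they are
connected after the right pins of the first chip have been identified with the left pins of the
second one. -/
noncomputable instance : Mul (Brauer n) where
  mul α β :=
    { partner := fun p => (existsUnique_connected α β p).choose
      partner_partner := fun p => by
        have h1 := (existsUnique_connected α β p).choose_spec.1
        exact ((existsUnique_connected α β _).choose_spec.2 p
          ⟨h1.1.symm, .symm _ _ h1.2⟩).symm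
      partner_ne := fun p => (existsUnique_connected α β p).choose_spec.1.1 }

theorem mul_partner_eq_iff (α β : Brauer n) (p q : Pin n) :
    (α * β).partner p = q ↔ q ≠ p ∧ Connected α β (outer p) (outer q) := by
  constructor
  · rintro rfl
    exact (existsUnique_connected α β p).choose_spec.1
  · intro h
    exact ((existsUnique_connected α β p).choose_spec.2 q h).symm

theorem connected_mul_partner (α β : Brauer n) (p : Pin n) :
    Connected α β (outer p) (outer ((α * β).partner p)) :=
  ((mul_partner_eq_iff α β p _).1 rfl).2

theorem connected_outer_outer_iff (α β : Brauer n) (p q : Pin n) :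
    Connected α β (outer p) (outer q) ↔ q = p ∨ q = (α * β).partner p := by
  constructor
  · intro h
    by_cases hq : q = p
    · exact .inl hq
    · exact .inr ((mul_partner_eq_iff α β p q).2 ⟨hq, h⟩).symm
  · rintro (rfl | rfl)
    · exact .refl _
    · exact connected_mul_partner _ _ _

/-- The identity chip, which joins every left pin to the opposite right pin. -/
instance : One (Brauer n) where
  one :=
    { partner := Sum.swap
      partner_partner := Sum.swap_swap
      partner_ne := by rintro (i | i) <;> simp }

theorem one_partner (p : Pin n) : (1 : Brauer n).partner p = p.swap := rfl

theorem ext_of_connected {α β γ : Brauer n}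
    (h : ∀ p, Connected α β (outer p) (outer (γ.partner p))) : α * β = γ := by
  ext1
  funext p
  exact (mul_partner_eq_iff _ _ _ _).2 ⟨γ.partner_ne p, h p⟩

protected theorem one_mul (α : Brauer n) : 1 * α = α := by
  apply ext_of_connected
  have key : ∀ p : Pin n, Connected 1 α (outer p) (Sum.inr p) := by
    rintro (i | i)
    · exact .trans _ _ _ (.rel _ _ (.first _)) (.rel _ _ (.glue i))
    · exact .refl _
  intro p
  exact .trans _ _ _ (key p) (.trans _ _ _ (.rel _ _ (.second p)) (.symm _ _ (key _)))

protected theorem mul_one (α : Brauer n) : α * 1 = α := by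
  apply ext_of_connected
  have key : ∀ p : Pin n, Connected α 1 (outer p) (Sum.inl p) := by
    rintro (i | i)
    · exact .refl _
    · exact .trans _ _ _ (.rel _ _ (.second _)) (.symm _ _ (.rel _ _ (.glue i)))
  intro p
  exact .trans _ _ _ (key p) (.trans _ _ _ (.rel _ _ (.first p)) (.symm _ _ (key _)))

/-- The connections between the pins of three chips put side by side. -/
inductive Wire₃ (α β γ : Brauer n) : Pin n ⊕ (Pin n ⊕ Pin n) → Pin n ⊕ (Pin n ⊕ Pin n) → Prop
  | first (p : Pin n) : Wire₃ α β γ (.inl p) (.inl (α.partner p))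
  | second (p : Pin n) : Wire₃ α β γ (.inr (.inl p)) (.inr (.inl (β.partner p)))
  | third (p : Pin n) : Wire₃ α β γ (.inr (.inr p)) (.inr (.inr (γ.partner p)))
  | glue₁ (i : Fin n) : Wire₃ α β γ (.inl (.inr i)) (.inr (.inl (.inl i)))
  | glue₂ (i : Fin n) : Wire₃ α β γ (.inr (.inl (.inr i))) (.inr (.inr (.inl i)))

/-- The outer pins of three chips put side by side. -/
def outer₃ : Pin n → Pin n ⊕ (Pin n ⊕ Pin n)
  | .inl i => .inl (.inl i)
  | .inr i => .inr (.inr (.inr i))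

theorem eqvGen_map {X Y : Type*} {r : X → X → Prop} {s : Y → Y → Prop} (f : X → Y)
    (h : ∀ x y, r x y → Relation.EqvGen s (f x) (f y)) {x y : X} (hxy : Relation.EqvGen r x y) :
    Relation.EqvGen s (f x) (f y) := by
  induction hxy with
  | rel x y hr => exact h x y hr
  | refl x => exact .refl _
  | symm x y _ ih => exact .symm _ _ ih
  | trans x y z _ _ ih1 ih2 => exact .trans _ _ _ ih1 ih2

theorem mul_mul_partner_connected₃ (α β γ : Brauer n) (p : Pin n) :
    Relation.EqvGen (Wire₃ α β γ) (outer₃ p) (outer₃ (((α * β) * γ).partner p)) := by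
  let e : TwoChips n → Pin n ⊕ (Pin n ⊕ Pin n)
    | .inl p => .inl p
    | .inr p => .inr (.inl p)
  have he : ∀ {x y}, Connected α β x y → Relation.EqvGen (Wire₃ α β γ) (e x) (e y) := by
    intro x y h
    refine eqvGen_map e ?_ h
    rintro _ _ (p | p | i)
    · exact .rel _ _ (.first p)
    · exact .rel _ _ (.second p)
    · exact .rel _ _ (.glue₁ i)
  let f : TwoChips n → Pin n ⊕ (Pin n ⊕ Pin n)
    | .inl p => e (outer p)
    | .inr p => .inr (.inr p)
  have hf : ∀ q : Pin n, f (outer q) = outer₃ q := by rintro (i | i) <;> rfl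
  rw [← hf, ← hf]
  refine eqvGen_map f ?_ (connected_mul_partner (α * β) γ p)
  rintro _ _ (p | p | i)
  · exact he (connected_mul_partner α β p)
  · exact .rel _ _ (.third p)
  · exact .rel _ _ (.glue₂ i)

theorem mul_mul_partner_connected₃' (α β γ : Brauer n) (p : Pin n) :
    Relation.EqvGen (Wire₃ α β γ) (outer₃ p) (outer₃ ((α * (β * γ)).partner p)) := by
  have he : ∀ {x y}, Connected β γ x y →
      Relation.EqvGen (Wire₃ α β γ) (Sum.inr x) (Sum.inr y) := by
    intro x y h
    refine eqvGen_map Sum.inr ?_ h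
    rintro _ _ (p | p | i)
    · exact .rel _ _ (.second p)
    · exact .rel _ _ (.third p)
    · exact .rel _ _ (.glue₂ i)
  let f : TwoChips n → Pin n ⊕ (Pin n ⊕ Pin n)
    | .inl p => .inl p
    | .inr p => .inr (outer p)
  have hf : ∀ q : Pin n, f (outer q) = outer₃ q := by rintro (i | i) <;> rfl
  rw [← hf, ← hf]
  refine eqvGen_map f ?_ (connected_mul_partner α (β * γ) p)
  rintro _ _ (p | p | i)
  · exact .rel _ _ (.first p)
  · exact he (connected_mul_partner β γ p)
  · exact .rel _ _ (.glue₁ i)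

open Classical in
/-- Pins of three chips that are connected and outer are connected after the first two chips have
been composed. -/
theorem connected_of_connected₃ (α β γ : Brauer n) (p q : Pin n)
    (h : Relation.EqvGen (Wire₃ α β γ) (outer₃ p) (outer₃ q)) :
    Connected (α * β) γ (outer p) (outer q) := by
  let c : TwoChips n → Option (Quot (Wire (α * β) γ)) := fun x =>
    if hx : ∃ r, Connected α β x (outer r) then some (Quot.mk _ (Sum.inl hx.choose)) else none
  have hc : ∀ {x y}, Connected α β x y → c x = c y := by
    intro x y hxy
    have hP : (fun r => Connected α β x (outer r)) = fun r => Connected α β y (outer r) := by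
      funext r
      exact propext ⟨fun h => .trans _ _ _ (.symm _ _ hxy) h, fun h => .trans _ _ _ hxy h⟩
    have : ∀ P Q : Pin n → Prop, P = Q →
        (if hx : ∃ r, P r then some (Quot.mk (Wire (α * β) γ) (Sum.inl hx.choose)) else none) =
        (if hx : ∃ r, Q r then some (Quot.mk (Wire (α * β) γ) (Sum.inl hx.choose)) else none) := by
      rintro P _ rfl
      rfl
    exact this _ _ hP
  have hco : ∀ r : Pin n, c (outer r) = some (Quot.mk _ (Sum.inl r)) := by
    intro r
    have hx : ∃ t, Connected α β (outer r) (outer t) := ⟨r, .refl _⟩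
    have h1 : c (outer r) = some (Quot.mk _ (Sum.inl hx.choose)) := dif_pos hx
    rw [h1]
    congr 1
    rcases (connected_outer_outer_iff α β r _).1 hx.choose_spec with h2 | h2
    · rw [h2]
    · rw [h2]
      exact (Quot.sound (Wire.first r)).symm
  let F : Pin n ⊕ (Pin n ⊕ Pin n) → Option (Quot (Wire (α * β) γ))
    | .inl p => c (.inl p)
    | .inr (.inl p) => c (.inr p)
    | .inr (.inr p) => some (Quot.mk _ (.inr p))
  have hF : ∀ {x y}, Relation.EqvGen (Wire₃ α β γ) x y → F x = F y := by
    intro x y hxy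
    induction hxy with
    | rel x y hr =>
      cases hr with
      | first p => exact hc (.rel _ _ (.first p))
      | second p => exact hc (.rel _ _ (.second p))
      | third p => exact congrArg some (Quot.sound (.second p))
      | glue₁ i => exact hc (.rel _ _ (.glue i))
      | glue₂ i => exact (hco (.inr i)).trans (congrArg some (Quot.sound (.glue i)))
    | refl x => rfl
    | symm x y _ ih => exact ih.symm
    | trans x y z _ _ ih1 ih2 => exact ih1.trans ih2
  have hFo : ∀ r : Pin n, F (outer₃ r) = some (Quot.mk _ (outer r)) := by
    rintro (i | i)
    · exact hco (.inl i)
    · rfl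
  have := hF h
  rw [hFo, hFo] at this
  exact Quot.eqvGen_exact (Option.some.inj this)

protected theorem mul_assoc (α β γ : Brauer n) : α * β * γ = α * (β * γ) :=
  ext_of_connected fun p => connected_of_connected₃ α β γ _ _ (mul_mul_partner_connected₃' α β γ p)

noncomputable instance : Monoid (Brauer n) where
  mul_assoc := Brauer.mul_assoc
  one_mul := Brauer.one_mul
  mul_one := Brauer.mul_one

/-- The rank: the number of lines, that is, of blocks that consist of a left and a right pin. -/
def rank (α : Brauer n) : ℕ :=
  (Finset.univ.filter fun i : Fin n => (α.partner (Sum.inl i)).isRight = true).card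

/-- The corank, `n - rank`; there is no truncation, since the rank is at most `n`. -/
def corank (α : Brauer n) : ℕ := n - α.rank

/-- `α.JoinsLL a b` says that the left pins with labels `a, b` in `{1, …, n}` form a block. -/
def JoinsLL (α : Brauer n) (a b : ℕ) : Prop :=
  ∃ i j : Fin n, i.val + 1 = a ∧ j.val + 1 = b ∧ α.partner (Sum.inl i) = Sum.inl j

/-- `α.JoinsLR a b` says that the left pin with label `a` in `{1, …, n}` and the right pin with
label `b` in `{1, …, n}` form a block. -/
def JoinsLR (α : Brauer n) (a b : ℕ) : Prop :=
  ∃ i j : Fin n, i.val + 1 = a ∧ j.val + 1 = b ∧ α.partner (Sum.inl i) = Sum.inr j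

/-- `α.JoinsRR a b` says that the right pins with labels `a, b` in `{1, …, n}` form a block. -/
def JoinsRR (α : Brauer n) (a b : ℕ) : Prop :=
  ∃ i j : Fin n, i.val + 1 = a ∧ j.val + 1 = b ∧ α.partner (Sum.inr i) = Sum.inr j

end Brauer

/-- Green's relation `R` on a monoid: two elements generate the same principal right ideal. -/
def GreenR {S : Type*} [Monoid S] (a b : S) : Prop :=
  Set.range (fun c : S => a * c) = Set.range (fun c : S => b * c)

/-- An `R`-cross-section of a monoid: a subsemigroup that contains exactly one element of every
class of Green's relation `R`. -/
def IsRCrossSection {S : Type*} [Monoid S] (T : Subsemigroup S) : Prop :=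
  ∀ a : S, ∃! t : S, t ∈ T ∧ GreenR a t

namespace Brauer

variable {n : ℕ}

/-- A canonical `R`-cross-section of the Brauer monoid: each of its elements `α` has a corank
`2 k` with `k ≤ n / 2`, and `(n - 2 k + 1)'` is joined to `(n - 2 k + 2)'`, …, `(n - 1)'` is
joined to `n'` in `α`. -/
def IsCanonical (T : Subsemigroup (Brauer n)) : Prop :=
  IsRCrossSection T ∧ ∀ α ∈ T, ∃ k ≤ n / 2, α.corank = 2 * k ∧
    ∀ m < k, α.JoinsRR (n - 2 * m - 1) (n - 2 * m)

/-- The parameter `α^(l)` of an element `α` is the identity of the symmetric group `S_2`. -/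
def ParamId (α : Brauer n) (l : ℕ) : Prop := α.JoinsLR (n - 2 * l + 2) (n - 2 * l)

/-- The parameter `α^(l)` of an element `α` is the transposition of the symmetric group `S_2`. -/
def ParamSwap (α : Brauer n) (l : ℕ) : Prop := α.JoinsLR (n - 2 * l + 2) (n - 2 * l - 1)

/-- The set of the pairs `(n - 3, n - 2), (n - 5, n - 4), …` of positive integers. -/
def pairSet (n : ℕ) : Set (ℕ × ℕ) :=
  {x | 1 ≤ x.1 ∧ x.2 = x.1 + 1 ∧ ∃ m, 1 ≤ m ∧ x.2 + 2 * m = n}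

/-- A canonical `R`-cross-section is regular if all parameters of its elements `α_{i,j}` are the
identity. Here `α_{i,j}` is the element of corank two that joins `i` to `j`, and it has the
parameters with index `1 ≤ l ≤ (n - j) / 2`, for `1 ≤ i < j < n - 1`. -/
def IsRegular (T : Subsemigroup (Brauer n)) : Prop :=
  IsCanonical T ∧ ∀ i j : ℕ, 1 ≤ i → i < j → j < n - 1 →
    ∀ α ∈ T, α.corank = 2 → α.JoinsLL i j → ∀ l, 1 ≤ l → l ≤ (n - j) / 2 → α.ParamId l

/-- A canonical `R`-cross-section is alternating if all parameters of its elements `α_{i,j}` are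
the transposition when `(i, j)` is not one of the pairs `(n - 3, n - 2), (n - 5, n - 4), …`, and
the identity when it is one of them. -/
def IsAlternating (T : Subsemigroup (Brauer n)) : Prop :=
  IsCanonical T ∧ ∀ i j : ℕ, 1 ≤ i → i < j → j < n - 1 →
    ∀ α ∈ T, α.corank = 2 → α.JoinsLL i j → ∀ l, 1 ≤ l → l ≤ (n - j) / 2 →
      ((i, j) ∉ pairSet n → α.ParamSwap l) ∧ ((i, j) ∈ pairSet n → α.ParamId l)

end Brauer

/-! Multiplication on the right keeps every left arc, and every chip whose left arcs include those
of `α` is a right multiple of `α`. Hence an R-class is a set of left arcs (`greenR_iff_leftEq`). A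
canonical cross-section puts the right arcs on the last pairs, so its only freedom is where the
lines end.

Existence: the left pins are treated in consecutive pairs, counted from the last pin, and each pair
is joined by `hook`, a left multiplication. A pair is already an arc, meets an arc that leaves it,
or lies on two lines. In the last case the lines must lead to the pair of right pins that comes
next, straight or crossed according to a flag; each pair of the second kind adds `w` to the flag.
The left arcs determine the case of every pair, so each class has exactly one admissible chip
(`Admissible.exists_leftEq`, `Admissible.eq_of_leftEq`). Hooks commute with right multiplication and
crossings add modulo two, so admissible chips are closed under products (`Admissible.mul`). A single
arc gives the flag `w`, or no crossing if it is itself a block: `w = false` is the regular case and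
`w = true` the alternating one.

Uniqueness: a canonical cross-section contains every `cap k`, by idempotency. An element with a left
arc beyond the last `k` pairs is `cap k * σ * β`, with `σ` of corank two and `β` in the
cross-section. The parameters make `cap k * σ` admissible, and induction treats `cap (k + 1) * β`.
So all elements are admissible (`admissible_of_hasParam`), and two cross-sections of which one
contains the other are equal.

Non-isomorphism: inside a cross-section, right divisibility is inclusion of left arcs, so the
elements of corank two are recognised by multiplication. Which elements absorb them tells whether
the larger end of the arc is in the last or the second last pair. An element of the second kind
sends the last two pins to the second last pair of right pins. In the regular case it always does so
straight, so that two such elements pull one arc back to the same arc. In the alternating case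
straight and crossed elements both occur; an arc pulled back by both that meets the last pair would
have to be the last pair itself. `HasCommonTargets` expresses this difference. -/

namespace Brauer

variable {n : ℕ}

/-! ### Products of chips -/

theorem connected_first {α β : Brauer n} {p q : Pin n} (h : α.partner p = q) :
    Connected α β (Sum.inl p) (Sum.inl q) := h ▸ .rel _ _ (.first p)

theorem connected_second {α β : Brauer n} {p q : Pin n} (h : β.partner p = q) :
    Connected α β (Sum.inr p) (Sum.inr q) := h ▸ .rel _ _ (.second p)

theorem connected_glue (α β : Brauer n) (i : Fin n) :
    Connected α β (Sum.inl (Sum.inr i)) (Sum.inr (Sum.inl i)) := .rel _ _ (.glue i)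

theorem partner_eq_comm {α : Brauer n} {p q : Pin n} : α.partner p = q ↔ α.partner q = p := by
  constructor <;> (rintro rfl; exact α.partner_partner _)

theorem partner_injective (α : Brauer n) : Function.Injective α.partner := fun p q h => by
  rw [← α.partner_partner p, h, α.partner_partner]

theorem ne_of_partner_eq {α : Brauer n} {p q : Pin n} (h : α.partner p = q) : q ≠ p :=
  h ▸ α.partner_ne p

/-- Arcs between left pins of the first factor are arcs of the product. -/
theorem mul_left_arc {α : Brauer n} (β : Brauer n) {i j : Fin n}
    (h : α.partner (.inl i) = .inl j) : (α * β).partner (.inl i) = .inl j :=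
  (mul_partner_eq_iff _ _ _ _).2 ⟨ne_of_partner_eq h, connected_first h⟩

/-- Arcs between right pins of the second factor are arcs of the product. -/
theorem mul_right_arc (α : Brauer n) {β : Brauer n} {i j : Fin n}
    (h : β.partner (.inr i) = .inr j) : (α * β).partner (.inr i) = .inr j :=
  (mul_partner_eq_iff _ _ _ _).2 ⟨ne_of_partner_eq h, connected_second h⟩

theorem mul_line_line {α β : Brauer n} {i j l : Fin n} (h : α.partner (.inl i) = .inr j)
    (h' : β.partner (.inl j) = .inr l) : (α * β).partner (.inl i) = .inr l :=
  (mul_partner_eq_iff _ _ _ _).2 ⟨by simp,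
    .trans _ _ _ (connected_first h) (.trans _ _ _ (connected_glue _ _ _) (connected_second h'))⟩

/-- An arc of the second factor that is reached by two lines of the first factor. -/
theorem mul_line_arc {α β : Brauer n} {i j l m : Fin n} (h : α.partner (.inl i) = .inr j)
    (h' : β.partner (.inl j) = .inl l) (h'' : α.partner (.inl m) = .inr l) :
    (α * β).partner (.inl i) = .inl m := by
  refine (mul_partner_eq_iff _ _ _ _).2 ⟨?_, .trans _ _ _ (connected_first h)
    (.trans _ _ _ (connected_glue _ _ _) (.trans _ _ _ (connected_second h')
    (.trans _ _ _ (.symm _ _ (connected_glue _ _ _)) (.symm _ _ (connected_first h'')))))⟩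
  intro hmi
  have hmi' : m = i := Sum.inl.inj hmi
  subst hmi'
  have : j = l := Sum.inr.inj (h.symm.trans h'')
  subst this
  exact β.partner_ne _ h'

/-! ### Left arcs and Green's relation -/

/-- The left arcs of `α` are left arcs of `β`. -/
def LeftLE (α β : Brauer n) : Prop :=
  ∀ i j, α.partner (.inl i) = .inl j → β.partner (.inl i) = .inl j

/-- Two chips with the same left arcs. -/
def LeftEq (α β : Brauer n) : Prop := LeftLE α β ∧ LeftLE β α

theorem LeftEq.symm {α β : Brauer n} (h : LeftEq α β) : LeftEq β α := ⟨h.2, h.1⟩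

theorem LeftLE.refl (α : Brauer n) : LeftLE α α := fun _ _ h => h

theorem LeftLE.trans {α β γ : Brauer n} (h : LeftLE α β) (h' : LeftLE β γ) : LeftLE α γ :=
  fun i j hij => h' i j (h i j hij)

theorem LeftEq.trans {α β γ : Brauer n} (h : LeftEq α β) (h' : LeftEq β γ) : LeftEq α γ :=
  ⟨h.1.trans h'.1, h'.2.trans h.2⟩

theorem leftLE_mul (α β : Brauer n) : LeftLE α (α * β) := fun _ _ h => mul_left_arc β h

/-- The mirror image of a chip. -/
def mirror (α : Brauer n) : Brauer n where
  partner p := (α.partner p.swap).swap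
  partner_partner p := by simp [α.partner_partner]
  partner_ne p h := α.partner_ne p.swap (by
    rw [← Sum.swap_swap (α.partner p.swap), h])

theorem mirror_partner (α : Brauer n) (p : Pin n) :
    α.mirror.partner p = (α.partner p.swap).swap := rfl

/-- The chip `α * α.mirror` has the left arcs of `α` and joins each remaining left pin to the
opposite right pin. Left multiplication by it therefore only imposes arcs that `β` already has. -/
theorem mul_mirror_mul {α β : Brauer n} (h : LeftLE α β) : α * α.mirror * β = β := by
  have hline : ∀ i a, α.partner (.inl i) = .inr a →
      (α * α.mirror).partner (.inl i) = .inr i := fun i a hi =>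
    mul_line_line hi (by rw [mirror_partner, Sum.swap_inl, partner_eq_comm.1 hi, Sum.swap_inl])
  have hleft : ∀ i, (∀ j, α.partner (.inl i) ≠ .inl j) → ∃ a, α.partner (.inl i) = .inr a := by
    intro i hi
    rcases ha : α.partner (.inl i) with j | a
    · exact absurd ha (hi j)
    · exact ⟨a, rfl⟩
  have hl : ∀ i, (α * α.mirror * β).partner (.inl i) = β.partner (.inl i) := by
    intro i
    rcases hi : α.partner (.inl i) with j | a
    · rw [h i j hi]
      exact mul_left_arc _ (mul_left_arc _ hi)
    · have hi' := hline i a hi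
      rcases hb : β.partner (.inl i) with j | b
      · obtain ⟨c, hc⟩ := hleft j fun m hm => by
          have h1 := h j m hm
          rw [partner_eq_comm.1 hb] at h1
          rw [← Sum.inl.inj h1, partner_eq_comm] at hm
          rw [hi] at hm
          exact Sum.inr_ne_inl hm
        exact mul_line_arc hi' hb (hline j c hc)
      · exact mul_line_line hi' hb
  ext1
  funext p
  rcases p with i | i
  · exact hl i
  · rcases hb : β.partner (.inr i) with j | j
    · rw [partner_eq_comm, hl, partner_eq_comm, hb]
    · exact mul_right_arc _ hb

theorem exists_eq_mul_of_leftLE {α β : Brauer n} (h : LeftLE α β) : ∃ γ, β = α * γ :=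
  ⟨α.mirror * β, by rw [← mul_assoc, mul_mirror_mul h]⟩

theorem _root_.GreenR.symm {S : Type*} [Monoid S] {a b : S} (h : GreenR a b) : GreenR b a :=
  Eq.symm h

theorem _root_.GreenR.exists_eq_mul {S : Type*} [Monoid S] {a b : S} (h : GreenR a b) :
    ∃ c, a = b * c := by
  have : a ∈ Set.range (fun c : S => a * c) := ⟨1, mul_one a⟩
  rw [h] at this
  obtain ⟨c, hc⟩ := this
  exact ⟨c, hc.symm⟩

theorem _root_.greenR_of_eq_mul {S : Type*} [Monoid S] {a b c d : S} (h : a = b * c)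
    (h' : b = a * d) : GreenR a b := by
  apply Set.Subset.antisymm
  · rintro _ ⟨x, rfl⟩
    exact ⟨c * x, by simp only [h, mul_assoc]⟩
  · rintro _ ⟨x, rfl⟩
    refine ⟨d * x, ?_⟩
    simp only
    rw [← mul_assoc, ← h']

theorem _root_.GreenR.mul_left {S : Type*} [Monoid S] {a b : S} (h : GreenR a b) (c : S) :
    GreenR (c * a) (c * b) := by
  obtain ⟨x, hx⟩ := h.exists_eq_mul
  obtain ⟨y, hy⟩ := h.symm.exists_eq_mul
  exact greenR_of_eq_mul (c := x) (d := y) (by rw [mul_assoc, ← hx]) (by rw [mul_assoc, ← hy])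

/-- Right multiplication never destroys a left arc, which gives one direction;
`exists_eq_mul_of_leftLE` supplies the two factors for the other. -/
theorem greenR_iff_leftEq {α β : Brauer n} : GreenR α β ↔ LeftEq α β := by
  constructor
  · intro h
    obtain ⟨x, hx⟩ := h.exists_eq_mul
    obtain ⟨y, hy⟩ := h.symm.exists_eq_mul
    exact ⟨by rw [hy]; exact leftLE_mul _ _, by rw [hx]; exact leftLE_mul _ _⟩
  · intro h
    obtain ⟨x, hx⟩ := exists_eq_mul_of_leftLE h.1
    obtain ⟨y, hy⟩ := exists_eq_mul_of_leftLE h.2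
    exact greenR_of_eq_mul hy hx

theorem LeftEq.mul_left {α β : Brauer n} (h : LeftEq α β) (γ : Brauer n) :
    LeftEq (γ * α) (γ * β) :=
  greenR_iff_leftEq.1 ((greenR_iff_leftEq.2 h).mul_left γ)

/-! ### Joining two left pins -/

/-- The chip in which the left pins `u` and `v` are joined to each other, and their former
partners are joined to each other. -/
def hook (u v : Fin n) (α : Brauer n) : Brauer n where
  partner p := Equiv.swap (.inl v) (α.partner (.inl u))
    (α.partner (Equiv.swap (.inl v) (α.partner (.inl u)) p))
  partner_partner p := by simp [α.partner_partner]
  partner_ne p h := by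
    rw [← Equiv.eq_symm_apply, Equiv.symm_swap] at h
    exact α.partner_ne _ h

theorem hook_partner (u v : Fin n) (α : Brauer n) (p : Pin n) :
    (hook u v α).partner p = Equiv.swap (.inl v) (α.partner (.inl u))
      (α.partner (Equiv.swap (.inl v) (α.partner (.inl u)) p)) := rfl

theorem hook_eq_self {u v : Fin n} {α : Brauer n} (h : α.partner (.inl u) = .inl v) :
    hook u v α = α := by
  ext1
  funext p
  simp [hook_partner, h]

/-- `hook` conjugates the partner map by a transposition that depends on the chip only through the
partner of `u`. Once this partner is known, the conjugation can be undone. -/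
theorem hook_injective {u v : Fin n} {α β : Brauer n} (h : hook u v α = hook u v β)
    (hu : α.partner (.inl u) = β.partner (.inl u)) : α = β := by
  ext1
  funext p
  have := congrArg (fun γ : Brauer n => γ.partner (Equiv.swap (.inl v) (α.partner (.inl u)) p)) h
  simpa [hook_partner, hu] using this

theorem hook_left {u v : Fin n} (huv : u ≠ v) (α : Brauer n) :
    (hook u v α).partner (.inl u) = .inl v := by
  have h : Equiv.swap (.inl v) (α.partner (.inl u)) (Sum.inl u) = .inl u :=
    Equiv.swap_apply_of_ne_of_ne (by simpa using huv) (α.partner_ne _).symm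
  rw [hook_partner, h, Equiv.swap_apply_right]

theorem hook_right {u v : Fin n} (huv : u ≠ v) (α : Brauer n) :
    (hook u v α).partner (.inl v) = .inl u := partner_eq_comm.1 (hook_left huv α)

theorem hook_of_ne {u v : Fin n} {α : Brauer n} {p : Pin n} (hu : p ≠ .inl u) (hv : p ≠ .inl v)
    (hu' : α.partner p ≠ .inl u) (hv' : α.partner p ≠ .inl v) :
    (hook u v α).partner p = α.partner p := by
  have h1 : p ≠ α.partner (.inl u) := fun h => hu' (partner_eq_comm.1 h.symm)
  have h2 : α.partner p ≠ α.partner (.inl u) := fun h => hu (α.partner_injective h)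
  rw [hook_partner, Equiv.swap_apply_of_ne_of_ne hv h1, Equiv.swap_apply_of_ne_of_ne hv' h2]

theorem hook_of_partner_left {u v : Fin n} (huv : u ≠ v) {α : Brauer n} {p : Pin n}
    (h : α.partner p = .inl u) :
    (hook u v α).partner p = α.partner (.inl v) := by
  have h1 : α.partner (.inl u) = p := partner_eq_comm.1 h
  have h2 : α.partner (.inl v) ≠ p := fun h2 => by
    rw [← h2, α.partner_partner] at h
    exact huv (Sum.inl.inj h).symm
  rw [hook_partner, h1, Equiv.swap_apply_right,
    Equiv.swap_apply_of_ne_of_ne (α.partner_ne _) h2]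

theorem hook_of_partner_right {u v : Fin n} (huv : u ≠ v) {α : Brauer n} {p : Pin n}
    (h : α.partner p = .inl v) : (hook u v α).partner p = α.partner (.inl u) := by
  have hv := (ne_of_partner_eq h).symm
  have h1 : p ≠ α.partner (.inl u) := fun h' => by
    rw [h', α.partner_partner] at h
    exact huv (Sum.inl.inj h)
  rw [hook_partner, Equiv.swap_apply_of_ne_of_ne hv h1, h, Equiv.swap_apply_left]

/-- The definition of `hook` singles out the partner of `u`. This symmetry reduces an arc at `v` to
an arc at `u`. -/
theorem hook_comm {u v : Fin n} (huv : u ≠ v) (α : Brauer n) : hook u v α = hook v u α := by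
  ext1
  funext p
  by_cases hu : p = .inl u
  · rw [hu, hook_left huv, hook_right huv.symm]
  by_cases hv : p = .inl v
  · rw [hv, hook_left huv.symm, hook_right huv]
  by_cases hu' : α.partner p = .inl u
  · rw [hook_of_partner_left huv hu', hook_of_partner_right huv.symm hu']
  by_cases hv' : α.partner p = .inl v
  · rw [hook_of_partner_right huv hv', hook_of_partner_left huv.symm hv']
  · rw [hook_of_ne hu hv hu' hv', hook_of_ne hv hu hv' hu']

/-- The right arc of `hook u v 1` connects the left pins `u` and `v` of `α`, and so joins their
former partners. As a left multiplication, `hook` commutes with right multiplication and respects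
`LeftEq`. -/
theorem hook_one_mul {u v : Fin n} (huv : u ≠ v) (α : Brauer n) :
    hook u v 1 * α = hook u v α := by
  apply ext_of_connected
  have hR : ∀ i : Fin n, i ≠ u → i ≠ v → (hook u v 1).partner (.inl i) = .inr i := by
    intro i hu hv
    exact hook_of_ne (α := (1 : Brauer n)) (by simpa using hu) (by simpa using hv)
      (by simp [one_partner]) (by simp [one_partner])
  have huvR : (hook u v 1).partner (.inr u) = .inr v := by
    rw [hook_of_partner_left huv (by simp [one_partner]), one_partner, Sum.swap_inl]
  have key : ∀ p : Pin n, p ≠ .inl u → p ≠ .inl v →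
      Connected (hook u v 1) α (outer p) (Sum.inr p) := by
    rintro (i | i) hu hv
    · exact .trans _ _ _ (connected_first (hR i (by simpa using hu) (by simpa using hv)))
        (connected_glue _ _ i)
    · exact .refl _
  have hmid : Connected (hook u v 1) α (Sum.inr (.inl u)) (Sum.inr (.inl v)) :=
    .trans _ _ _ (.symm _ _ (connected_glue _ _ u))
      (.trans _ _ _ (connected_first huvR) (connected_glue _ _ v))
  intro p
  by_cases hu : p = .inl u
  · rw [hu, hook_left huv]
    exact connected_first (hook_left huv 1)
  by_cases hv : p = .inl v
  · rw [hv, hook_right huv]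
    exact connected_first (hook_right huv 1)
  refine .trans _ _ _ (key p hu hv) ?_
  by_cases hu' : α.partner p = .inl u
  · rw [hook_of_partner_left huv hu']
    refine .trans _ _ _ (connected_second hu') (.trans _ _ _ hmid (.trans _ _ _
      (connected_second rfl) (.symm _ _ (key _ ?_ (α.partner_ne _)))))
    rw [← hu']
    exact fun h => hv (α.partner_injective h).symm
  by_cases hv' : α.partner p = .inl v
  · rw [hook_of_partner_right huv hv']
    refine .trans _ _ _ (connected_second hv') (.trans _ _ _ (.symm _ _ hmid) (.trans _ _ _
      (connected_second rfl) (.symm _ _ (key _ (α.partner_ne _) ?_))))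
    rw [← hv']
    exact fun h => hu (α.partner_injective h).symm
  · rw [hook_of_ne hu hv hu' hv']
    exact .trans _ _ _ (connected_second rfl) (.symm _ _ (key _ hu' hv'))

theorem hook_mul {u v : Fin n} (huv : u ≠ v) (α β : Brauer n) :
    hook u v α * β = hook u v (α * β) := by
  rw [← hook_one_mul huv α, mul_assoc, hook_one_mul huv]

theorem LeftEq.hook {u v : Fin n} (huv : u ≠ v) {α β : Brauer n} (h : LeftEq α β) :
    LeftEq (hook u v α) (hook u v β) := by
  rw [← hook_one_mul huv α, ← hook_one_mul huv β]
  exact h.mul_left _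

/-! ### Blocks of consecutive pins -/

/-- `u` and `v` are the pins labelled `n - 2 k - 1` and `n - 2 k`. -/
structure IsBlock (k : ℕ) (u v : Fin n) : Prop where
  fst : u.val + 2 * k + 2 = n
  snd : v.val + 2 * k + 1 = n

theorem IsBlock.val_lt {k : ℕ} {u v : Fin n} (h : IsBlock k u v) : u.val < v.val := by
  have := h.fst; have := h.snd; omega

theorem IsBlock.ne {k : ℕ} {u v : Fin n} (h : IsBlock k u v) : u ≠ v := by
  rintro rfl; exact lt_irrefl _ h.val_lt

theorem IsBlock.le {k : ℕ} {u v : Fin n} (h : IsBlock k u v) : 2 * k + 2 ≤ n := by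
  have := h.fst; omega

theorem IsBlock.unique {k : ℕ} {u v u' v' : Fin n} (h : IsBlock k u v) (h' : IsBlock k u' v') :
    u' = u ∧ v' = v := by
  have := h.fst; have := h.snd; have := h'.fst; have := h'.snd
  constructor <;> (apply Fin.ext; omega)

theorem exists_isBlock {k : ℕ} (h : 2 * k + 2 ≤ n) : ∃ u v : Fin n, IsBlock k u v :=
  ⟨⟨n - 2 * k - 2, by omega⟩, ⟨n - 2 * k - 1, by omega⟩, by simp only; omega, by simp only; omega⟩

theorem exists_isBlock_of_le {k : ℕ} {j : Fin n} (hk : 2 * k ≤ n) (h : n ≤ j.val + 2 * k) :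
    ∃ t < k, ∃ u v, IsBlock t u v ∧ (j = u ∨ j = v) := by
  have hj := j.isLt
  have ht : 2 * ((n - 1 - j.val) / 2) + 2 ≤ n := by omega
  obtain ⟨u, v, huv⟩ := exists_isBlock ht
  refine ⟨(n - 1 - j.val) / 2, by omega, u, v, huv, ?_⟩
  have := huv.fst; have := huv.snd
  rcases Nat.even_or_odd' (n - 1 - j.val) with ⟨c, hc | hc⟩
  · right; apply Fin.ext; omega
  · left; apply Fin.ext; omega

theorem val_lt_of_ne_isBlock {k : ℕ} {j u v : Fin n} (h : IsBlock k u v) (hj : j.val + 2 * k < n)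
    (hu : j ≠ u) (hv : j ≠ v) : j.val + 2 * (k + 1) < n := by
  have := h.fst; have := h.snd
  have : j.val ≠ u.val := fun h => hu (Fin.ext h)
  have : j.val ≠ v.val := fun h => hv (Fin.ext h)
  omega

/-! ### Chips with prescribed arcs -/

/-- The last `k` pairs of left pins are joined. -/
def LeftCapped (k : ℕ) (α : Brauer n) : Prop :=
  ∀ t < k, ∀ u v, IsBlock t u v → α.partner (.inl u) = .inl v

/-- The last `k` pairs of right pins are joined, and the other right pins belong to lines. -/
structure RightCapped (k : ℕ) (α : Brauer n) : Prop where
  le : 2 * k ≤ n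
  arc : ∀ t < k, ∀ u v, IsBlock t u v → α.partner (.inr u) = .inr v
  line : ∀ j : Fin n, j.val + 2 * k < n → ∃ i, α.partner (.inr j) = .inl i

theorem LeftCapped.val_lt {k : ℕ} {α : Brauer n} (hk : 2 * k ≤ n) (h : LeftCapped k α) {i j : Fin n}
    (hi : i.val + 2 * k < n) (hij : α.partner (.inl i) = .inl j) : j.val + 2 * k < n := by
  by_contra hj
  obtain ⟨t, ht, u, v, huv, hju⟩ := exists_isBlock_of_le hk (not_lt.1 hj)
  have hut := h t ht u v huv
  have := huv.fst; have := huv.snd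
  rw [partner_eq_comm] at hij
  rcases hju with rfl | rfl
  · have : i = v := Sum.inl.inj (hij.symm.trans hut)
    subst this; omega
  · rw [partner_eq_comm] at hut
    have : i = u := Sum.inl.inj (hij.symm.trans hut)
    subst this; omega

theorem LeftCapped.val_lt_of_line {k : ℕ} {α : Brauer n} (hk : 2 * k ≤ n) (h : LeftCapped k α)
    {i j : Fin n} (hij : α.partner (.inl i) = .inr j) : i.val + 2 * k < n := by
  by_contra hi
  obtain ⟨t, ht, u, v, huv, hju⟩ := exists_isBlock_of_le hk (not_lt.1 hi)
  have hut := h t ht u v huv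
  rcases hju with rfl | rfl
  · rw [hij] at hut; exact Sum.inr_ne_inl hut
  · rw [partner_eq_comm, hij] at hut; exact Sum.inr_ne_inl hut

theorem LeftCapped.mul_right {k : ℕ} {α : Brauer n} (h : LeftCapped k α) (β : Brauer n) :
    LeftCapped k (α * β) := fun t ht u v huv => mul_left_arc β (h t ht u v huv)

theorem LeftCapped.succ {k : ℕ} {α : Brauer n} (h : LeftCapped k α) {u v : Fin n}
    (huv : IsBlock k u v) (huv' : α.partner (.inl u) = .inl v) : LeftCapped (k + 1) α := by
  intro t ht a b hab
  rcases Nat.lt_succ_iff_lt_or_eq.1 ht with ht | rfl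
  · exact h t ht a b hab
  · obtain ⟨rfl, rfl⟩ := huv.unique hab
    exact huv'

theorem LeftCapped.hook {k : ℕ} {α : Brauer n} (h : LeftCapped k α) {u v : Fin n}
    (huv : IsBlock k u v) : LeftCapped (k + 1) (hook u v α) := by
  refine LeftCapped.succ ?_ huv (hook_left huv.ne α)
  intro t ht a b hab
  have h' := h t ht a b hab
  rw [hook_of_ne, h']
  all_goals
    try rw [h']
    simp only [ne_eq, Sum.inl.injEq]
    rintro rfl
    have := hab.fst; have := hab.snd; have := huv.fst; have := huv.snd; omega

theorem RightCapped.val_lt_of_line {k : ℕ} {α : Brauer n} (h : RightCapped k α) {i j : Fin n}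
    (hij : α.partner (.inr j) = .inl i) : j.val + 2 * k < n := by
  by_contra hi
  obtain ⟨t, ht, u, v, huv, hju⟩ := exists_isBlock_of_le h.le (not_lt.1 hi)
  have hut := h.arc t ht u v huv
  rcases hju with rfl | rfl
  · rw [hij] at hut; exact Sum.inl_ne_inr hut
  · rw [partner_eq_comm, hij] at hut; exact Sum.inl_ne_inr hut

/-- If `u` or `v` lies on a left arc, joining the former partners at most moves the left end of one
line. The right arcs are the same before and after. -/
theorem rightCapped_of_hook {k : ℕ} {α : Brauer n} {u v : Fin n} (huv : u ≠ v)
    (h : RightCapped k (hook u v α))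
    (hl : (∃ i, α.partner (.inl u) = .inl i) ∨ ∃ i, α.partner (.inl v) = .inl i) :
    RightCapped k α := by
  have key : ∀ j, (∃ i, (hook u v α).partner (.inr j) = .inl i) ↔
      ∃ i, α.partner (.inr j) = .inl i := by
    intro j
    by_cases hu : α.partner (.inr j) = .inl u
    · rw [hook_of_partner_left huv hu, hu]
      rcases hl with ⟨i, hi⟩ | ⟨i, hi⟩
      · rw [partner_eq_comm, hi] at hu; exact absurd hu (by simp)
      · simp [hi]
    by_cases hv : α.partner (.inr j) = .inl v
    · rw [hook_of_partner_right huv hv, hv]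
      rcases hl with ⟨i, hi⟩ | ⟨i, hi⟩
      · simp [hi]
      · rw [partner_eq_comm, hi] at hv; exact absurd hv (by simp)
    · rw [hook_of_ne (by simp) (by simp) hu hv]
  refine ⟨h.le, fun t ht a b hab => ?_, fun j hj => (key j).1 (h.line j hj)⟩
  have h1 := h.arc t ht a b hab
  by_cases hu : α.partner (.inr a) = .inl u
  · obtain ⟨i, hi⟩ := (key a).2 ⟨u, hu⟩
    rw [h1] at hi; exact absurd hi (by simp)
  by_cases hv : α.partner (.inr a) = .inl v
  · obtain ⟨i, hi⟩ := (key a).2 ⟨v, hv⟩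
    rw [h1] at hi; exact absurd hi (by simp)
  · rwa [hook_of_ne (by simp) (by simp) hu hv] at h1

/-- If `u` and `v` lie on lines, the hook turns their two right ends into one new right arc, here
the block `k`. Without the hook exactly this arc is missing. -/
theorem rightCapped_of_hook_line {k : ℕ} {α : Brauer n} {u v u' v' : Fin n}
    (huv' : IsBlock k u' v') (h : RightCapped (k + 1) (hook u v α))
    (hl : α.partner (.inl u) = .inr u' ∧ α.partner (.inl v) = .inr v' ∨
      α.partner (.inl u) = .inr v' ∧ α.partner (.inl v) = .inr u') :
    RightCapped k α := by
  have hu' : ∃ i, α.partner (.inr u') = .inl i := by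
    rcases hl with ⟨h1, h2⟩ | ⟨h1, h2⟩
    exacts [⟨u, partner_eq_comm.1 h1⟩, ⟨v, partner_eq_comm.1 h2⟩]
  have hv' : ∃ i, α.partner (.inr v') = .inl i := by
    rcases hl with ⟨h1, h2⟩ | ⟨h1, h2⟩
    exacts [⟨v, partner_eq_comm.1 h2⟩, ⟨u, partner_eq_comm.1 h1⟩]
  have key : ∀ j, j ≠ u' → j ≠ v' →
      (hook u v α).partner (.inr j) = α.partner (.inr j) := by
    intro j hju hjv
    refine hook_of_ne (by simp) (by simp) ?_ ?_ <;> intro hj <;>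
      rcases hl with ⟨h1, h2⟩ | ⟨h1, h2⟩ <;> rw [partner_eq_comm] at hj <;> simp_all
  refine ⟨by have := h.le; omega, fun t ht a b hab => ?_, fun j hj => ?_⟩
  · rw [← key]
    · exact h.arc t (by omega) a b hab
    all_goals
      rintro rfl
      have := hab.fst; have := huv'.fst; have := huv'.snd; omega
  · by_cases hju : j = u'
    · exact hju ▸ hu'
    by_cases hjv : j = v'
    · exact hjv ▸ hv'
    rw [← key j hju hjv]
    exact h.line j (val_lt_of_ne_isBlock huv' hj hju hjv)

/-! ### The chips that join the last pairs of pins -/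

/-- The chip in which the last `k` pairs of left pins and the last `k` pairs of right pins are
joined, and the other left pins are joined to the opposite right pins. -/
def cap : ℕ → Brauer n
  | 0 => 1
  | k + 1 => if h : 2 * k + 2 ≤ n then
      hook ⟨n - 2 * k - 2, by omega⟩ ⟨n - 2 * k - 1, by omega⟩ (cap k) else cap k

theorem cap_zero : cap 0 = (1 : Brauer n) := rfl

theorem cap_succ {k : ℕ} {u v : Fin n} (h : IsBlock k u v) : cap (k + 1) = hook u v (cap k) := by
  have h1 := h.le
  have h2 := h.fst
  have h3 := h.snd
  rw [cap, dif_pos h1]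
  congr 1 <;> (apply Fin.ext; simp only; omega)

theorem leftCapped_cap (k : ℕ) (hk : 2 * k ≤ n) : LeftCapped k (cap k : Brauer n) := by
  induction k with
  | zero => intro t ht; omega
  | succ k ih =>
    obtain ⟨u, v, huv⟩ := exists_isBlock (n := n) (k := k) (by omega)
    rw [cap_succ huv]
    exact (ih (by omega)).hook huv

theorem cap_line (k : ℕ) (hk : 2 * k ≤ n) (i : Fin n) (hi : i.val + 2 * k < n) :
    (cap k : Brauer n).partner (.inl i) = .inr i := by
  induction k with
  | zero => rfl
  | succ k ih =>
    obtain ⟨u, v, huv⟩ := exists_isBlock (n := n) (k := k) (by omega)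
    have h1 := ih (by omega) (by omega)
    have := huv.fst; have := huv.snd
    rw [cap_succ huv, hook_of_ne, h1] <;> try rw [h1]
    all_goals simp only [ne_eq, Sum.inl.injEq, reduceCtorEq, not_false_eq_true]
    all_goals rintro rfl; omega

theorem rightCapped_cap (k : ℕ) (hk : 2 * k ≤ n) : RightCapped k (cap k : Brauer n) := by
  refine ⟨hk, ?_, fun j hj => ⟨j, partner_eq_comm.1 (cap_line k hk j hj)⟩⟩
  induction k with
  | zero => intro t ht; omega
  | succ k ih =>
    obtain ⟨u, v, huv⟩ := exists_isBlock (n := n) (k := k) (by omega)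
    intro t ht a b hab
    have hlu : (cap k : Brauer n).partner (.inr u) = .inl u :=
      partner_eq_comm.1 (cap_line k (by omega) u (by have := huv.fst; omega))
    have hlv : (cap k : Brauer n).partner (.inl v) = .inr v :=
      cap_line k (by omega) v (by have := huv.snd; omega)
    rw [cap_succ huv]
    rcases Nat.lt_succ_iff_lt_or_eq.1 ht with ht | rfl
    · have h1 := ih (by omega) t ht a b hab
      rw [hook_of_ne, h1] <;> simp [h1]
    · obtain ⟨rfl, rfl⟩ := huv.unique hab
      rw [hook_of_partner_left huv.ne hlu, hlv]

theorem cap_succ_mul {k : ℕ} {u v : Fin n} (h : IsBlock k u v) (α : Brauer n) :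
    cap (k + 1) * α = hook u v (cap k * α) := by
  rw [cap_succ h, hook_mul h.ne]

theorem LeftCapped.leftLE {k : ℕ} (hk : 2 * k ≤ n) {α : Brauer n} (h : LeftCapped k α) :
    LeftLE (cap k) α := by
  intro i j hij
  by_cases hi : i.val + 2 * k < n
  · rw [cap_line k hk i hi] at hij
    exact absurd hij (by simp)
  · obtain ⟨t, ht, u, v, huv, hiu⟩ := exists_isBlock_of_le hk (not_lt.1 hi)
    have h1 := leftCapped_cap k hk t ht u v huv
    have h2 := h t ht u v huv
    rcases hiu with rfl | rfl
    · rw [h2, ← h1, hij]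
    · rw [partner_eq_comm] at h1 h2
      rw [h2, ← h1, hij]

theorem LeftCapped.cap_mul {k : ℕ} (hk : 2 * k ≤ n) {α : Brauer n} (h : LeftCapped k α) :
    cap k * α = α := by
  induction k with
  | zero => rw [cap_zero, one_mul]
  | succ k ih =>
    obtain ⟨u, v, huv⟩ := exists_isBlock (n := n) (k := k) (by omega)
    rw [cap_succ_mul huv, ih (by omega) fun t ht => h t (by omega)]
    exact hook_eq_self (h k (by omega) u v huv)

/-- Consequently `α * β = α * (cap k * β)`: only the capped version of the second factor matters. -/
theorem RightCapped.mul_cap {k : ℕ} {α : Brauer n} (h : RightCapped k α) : α * cap k = α := by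
  have hl : ∀ i, (α * cap k).partner (.inl i) = α.partner (.inl i) := by
    intro i
    rcases hi : α.partner (.inl i) with j | j
    · exact mul_left_arc _ hi
    · exact mul_line_line hi (cap_line k h.le j (h.val_lt_of_line (partner_eq_comm.1 hi)))
  ext1
  funext p
  rcases p with i | i
  · exact hl i
  · by_cases hi : i.val + 2 * k < n
    · obtain ⟨j, hj⟩ := h.line i hi
      rw [partner_eq_comm, hj, hl, partner_eq_comm, hj]
    · obtain ⟨t, ht, u, v, huv, hiu⟩ := exists_isBlock_of_le h.le (not_lt.1 hi)
      have h1 := mul_right_arc α ((rightCapped_cap k h.le).arc t ht u v huv)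
      have h2 := h.arc t ht u v huv
      rcases hiu with rfl | rfl
      · rw [h1, h2]
      · rw [partner_eq_comm] at h1 h2
        rw [h1, h2]

/-! ### Ranks -/

theorem rank_eq_card_right (α : Brauer n) : α.rank =
    (Finset.univ.filter fun j : Fin n => (α.partner (Sum.inr j)).isLeft = true).card := by
  classical
  unfold rank
  refine Finset.card_bij' (fun i _ => (α.partner (.inl i)).elim id id)
    (fun j _ => (α.partner (.inr j)).elim id id) ?_ ?_ ?_ ?_
  · intro i hi
    rw [Finset.mem_filter] at hi
    obtain ⟨j, hj⟩ := Sum.isRight_iff.1 hi.2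
    simp [hj, partner_eq_comm.1 hj]
  · intro j hj
    rw [Finset.mem_filter] at hj
    obtain ⟨i, hi⟩ := Sum.isLeft_iff.1 hj.2
    simp [hi, partner_eq_comm.1 hi]
  · intro i hi
    rw [Finset.mem_filter] at hi
    obtain ⟨j, hj⟩ := Sum.isRight_iff.1 hi.2
    simp [hj, partner_eq_comm.1 hj]
  · intro j hj
    rw [Finset.mem_filter] at hj
    obtain ⟨i, hi⟩ := Sum.isLeft_iff.1 hj.2
    simp [hi, partner_eq_comm.1 hi]

theorem LeftEq.rank_eq {α β : Brauer n} (h : LeftEq α β) : α.rank = β.rank := by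
  unfold rank
  congr 1
  ext i
  simp only [Finset.mem_filter, Finset.mem_univ, true_and]
  rw [← not_iff_not, Sum.not_isRight, Sum.not_isRight, Sum.isLeft_iff, Sum.isLeft_iff]
  exact ⟨fun ⟨j, hj⟩ => ⟨j, h.1 _ _ hj⟩, fun ⟨j, hj⟩ => ⟨j, h.2 _ _ hj⟩⟩

theorem LeftEq.corank_eq {α β : Brauer n} (h : LeftEq α β) : α.corank = β.corank := by
  rw [corank, corank, h.rank_eq]

theorem card_filter_val_add_lt (m : ℕ) :
    (Finset.univ.filter fun j : Fin n => j.val + m < n).card = n - m := by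
  rw [← Fintype.card_fin (n - m), ← Finset.card_univ]
  refine (Finset.card_bij (fun (i : Fin (n - m)) _ => (⟨i.val, by omega⟩ : Fin n)) ?_ ?_ ?_).symm
  · intro i _
    simp only [Finset.mem_filter, Finset.mem_univ, true_and]
    omega
  · intro i _ j _ h
    exact Fin.ext (by simpa using h)
  · intro j hj
    simp only [Finset.mem_filter, Finset.mem_univ, true_and] at hj
    exact ⟨⟨j.val, by omega⟩, Finset.mem_univ _, rfl⟩

theorem RightCapped.corank {k : ℕ} {α : Brauer n} (h : RightCapped k α) :
    α.corank = 2 * k := by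
  have : α.rank = n - 2 * k := by
    rw [rank_eq_card_right, ← card_filter_val_add_lt]
    congr 1
    ext j
    simp only [Finset.mem_filter, Finset.mem_univ, true_and, Sum.isLeft_iff]
    exact ⟨fun ⟨i, hi⟩ => h.val_lt_of_line hi, fun hj => h.line j hj⟩
  have := h.le
  rw [Brauer.corank]
  omega

/-- The normal form of the right hand side of the elements of a canonical cross-section. -/
theorem canonical_iff_rightCapped {α : Brauer n} : (∃ k ≤ n / 2, α.corank = 2 * k ∧
    ∀ m < k, α.JoinsRR (n - 2 * m - 1) (n - 2 * m)) ↔ ∃ k, RightCapped k α := by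
  constructor
  · rintro ⟨k, hk, hc, hj⟩
    have harc : ∀ t < k, ∀ u v, IsBlock t u v → α.partner (.inr u) = .inr v := by
      intro t ht u v huv
      obtain ⟨i, j, hi, hj, hij⟩ := hj t ht
      have := huv.fst; have := huv.snd
      have : i = u := Fin.ext (by omega)
      have : j = v := Fin.ext (by omega)
      subst i j
      exact hij
    refine ⟨k, by omega, harc, ?_⟩
    -- The last `k` pairs use up `2 * k` right pins that lie on no line. The corank allows no
    -- further ones, so the inclusion is an equality.
    have hsub : (Finset.univ.filter fun j : Fin n => (α.partner (Sum.inr j)).isLeft = true) ⊆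
        Finset.univ.filter fun j : Fin n => j.val + 2 * k < n := by
      intro j hj
      simp only [Finset.mem_filter, Finset.mem_univ, true_and, Sum.isLeft_iff] at hj ⊢
      obtain ⟨i, hi⟩ := hj
      by_contra hlt
      obtain ⟨t, ht, u, v, huv, hju⟩ := exists_isBlock_of_le (by omega) (not_lt.1 hlt)
      have h1 := harc t ht u v huv
      rcases hju with rfl | rfl
      · rw [hi] at h1; exact Sum.inl_ne_inr h1
      · rw [partner_eq_comm, hi] at h1; exact Sum.inl_ne_inr h1
    have hle : α.rank ≤ n := by
      unfold rank
      exact (Finset.card_le_univ _).trans (by simp)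
    have heq := Finset.eq_of_subset_of_card_le hsub (by
      rw [card_filter_val_add_lt, ← rank_eq_card_right]
      rw [Brauer.corank] at hc
      omega)
    intro j hj
    have : j ∈ Finset.univ.filter fun j : Fin n => j.val + 2 * k < n := by simpa using hj
    rw [← heq] at this
    simpa [Sum.isLeft_iff] using this
  · rintro ⟨k, h⟩
    refine ⟨k, by have := h.le; omega, h.corank, fun m hm => ?_⟩
    obtain ⟨u, v, huv⟩ := exists_isBlock (n := n) (k := m) (by have := h.le; omega)
    have := huv.fst; have := huv.snd
    exact ⟨u, v, by omega, by omega, h.arc m hm u v huv⟩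

theorem LeftCapped.leftEq_cap {k : ℕ} (hk : 2 * k ≤ n) {α : Brauer n} (h : LeftCapped k α)
    (h' : ∀ i j : Fin n, i.val + 2 * k < n → i < j → j.val + 2 * k < n →
      α.partner (.inl i) ≠ .inl j) : LeftEq α (cap k) := by
  refine ⟨fun i j hij => ?_, h.leftLE hk⟩
  by_cases hi : i.val + 2 * k < n
  · have hj := h.val_lt hk hi hij
    rcases lt_trichotomy i j with hlt | rfl | hlt
    · exact absurd hij (h' i j hi hlt hj)
    · exact absurd hij (α.partner_ne _)
    · exact absurd (partner_eq_comm.1 hij) (h' j i hj hlt hi)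
  · obtain ⟨t, ht, u, v, huv, hiu⟩ := exists_isBlock_of_le hk (not_lt.1 hi)
    have h1 := leftCapped_cap k hk t ht u v huv
    have h2 := h t ht u v huv
    rcases hiu with rfl | rfl
    · rw [h1, ← h2, hij]
    · rw [partner_eq_comm] at h1 h2
      rw [h1, ← h2, hij]

/-! ### Admissible chips -/

/-- The chips with parameter `w` in normal form. Beginning with the pair `k`, the remaining pairs of
left pins are joined one after the other by `hook`. If both pins of a pair belong to lines at that
moment, then these lines lead to a pair of right pins, in the same order if the flag `b` is false,
and in the opposite order otherwise. The flag `b` is the sum of one `w` for every later pair that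
has a pin in a left arc to a pin outside of the pair at the moment when the pair is joined. The
number `κ` is the number of right arcs, which are the last `κ` pairs. -/
inductive Admissible (w : Bool) : ℕ → ℕ → Bool → Brauer n → Prop
  | base {k : ℕ} : 2 * k ≤ n → n < 2 * k + 2 → Admissible w k k false (cap k)
  | circle {k κ : ℕ} {b : Bool} {α : Brauer n} {u v : Fin n} : IsBlock k u v →
      α.partner (.inl u) = .inl v → Admissible w (k + 1) κ b α → Admissible w k κ b α
  | absorb {k κ : ℕ} {b : Bool} {α : Brauer n} {u v : Fin n} : IsBlock k u v →
      α.partner (.inl u) ≠ .inl v →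
      ((∃ i, α.partner (.inl u) = .inl i) ∨ ∃ i, α.partner (.inl v) = .inl i) →
      Admissible w (k + 1) κ b (hook u v α) → Admissible w k κ (b ^^ w) α
  | through {k κ : ℕ} {b : Bool} {α : Brauer n} {u v u' v' : Fin n} : IsBlock k u v →
      IsBlock κ u' v' → α.partner (.inl u) = .inr (cond b v' u') →
      α.partner (.inl v) = .inr (cond b u' v') →
      Admissible w (k + 1) (κ + 1) b (hook u v α) → Admissible w k κ b α

namespace Admissible

variable {w : Bool}

theorem rightCapped {k κ : ℕ} {b : Bool} {α : Brauer n} (h : Admissible w k κ b α) :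
    RightCapped κ α := by
  induction h with
  | base h1 h2 => exact rightCapped_cap _ h1
  | circle _ _ _ ih => exact ih
  | absorb huv _ hl _ ih => exact rightCapped_of_hook huv.ne ih hl
  | @through k κ b α u v u' v' huv huv' hu hv _ ih =>
    refine rightCapped_of_hook_line huv' ih ?_
    cases b
    · exact .inl ⟨hu, hv⟩
    · exact .inr ⟨hu, hv⟩

theorem le {k κ : ℕ} {b : Bool} {α : Brauer n} (h : Admissible w k κ b α) : k ≤ κ := by
  induction h <;> omega

theorem two_mul_le {k κ : ℕ} {b : Bool} {α : Brauer n} (h : Admissible w k κ b α) :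
    2 * k ≤ n := by
  have := h.le; have := h.rightCapped.le; omega

/-- The left arcs decide which constructor applies at the pair `k`, and `LeftEq` passes to the
hooked chips. The chip is recovered by `hook_injective`: the partner of a pin of the pair is either
given by a common arc or prescribed by `κ` and `b`. -/
theorem eq_of_leftEq {k κ κ' : ℕ} {b b' : Bool} {α β : Brauer n} (h : Admissible w k κ b α)
    (h' : Admissible w k κ' b' β) (hαβ : LeftEq α β) : κ = κ' ∧ b = b' ∧ α = β := by
  induction h generalizing κ' b' β with
  | base h1 h2 =>
    cases h' with
    | base => exact ⟨rfl, rfl, rfl⟩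
    | circle h => exact absurd h.le (by omega)
    | absorb h => exact absurd h.le (by omega)
    | through h => exact absurd h.le (by omega)
  | @circle k κ b α u v huv hc h ih =>
    cases h' with
    | base => exact absurd huv.le (by omega)
    | circle _ _ h' => exact ih h' hαβ
    | absorb huv' hne =>
      obtain ⟨rfl, rfl⟩ := huv.unique huv'
      exact absurd (hαβ.1 _ _ hc) hne
    | through huv' _ hu =>
      obtain ⟨rfl, rfl⟩ := huv.unique huv'
      rw [hαβ.1 _ _ hc] at hu
      exact absurd hu (by simp)
  | @absorb k κ b α u v huv hne hl h ih =>
    cases h' with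
    | base => exact absurd huv.le (by omega)
    | circle huv' hc =>
      obtain ⟨rfl, rfl⟩ := huv.unique huv'
      exact absurd (hαβ.2 _ _ hc) hne
    | absorb huv' _ _ h' =>
      obtain ⟨rfl, rfl⟩ := huv.unique huv'
      obtain ⟨rfl, rfl, heq⟩ := ih h' (hαβ.hook huv.ne)
      refine ⟨rfl, rfl, ?_⟩
      rcases hl with ⟨i, hi⟩ | ⟨i, hi⟩
      · exact hook_injective heq (hi.trans (hαβ.1 _ _ hi).symm)
      · rw [hook_comm huv.ne, hook_comm huv.ne] at heq
        exact hook_injective heq (hi.trans (hαβ.1 _ _ hi).symm)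
    | through huv' _ hu hv =>
      obtain ⟨rfl, rfl⟩ := huv.unique huv'
      rcases hl with ⟨i, hi⟩ | ⟨i, hi⟩
      · rw [hαβ.1 _ _ hi] at hu
        exact absurd hu (by simp)
      · rw [hαβ.1 _ _ hi] at hv
        exact absurd hv (by simp)
  | @through k κ b α u v u' v' huv huv' hu hv h ih =>
    cases h' with
    | base => exact absurd huv.le (by omega)
    | circle huv₂ hc =>
      obtain ⟨rfl, rfl⟩ := huv.unique huv₂
      rw [hαβ.2 _ _ hc] at hu
      exact absurd hu (by simp)
    | absorb huv₂ _ hl =>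
      obtain ⟨rfl, rfl⟩ := huv.unique huv₂
      rcases hl with ⟨i, hi⟩ | ⟨i, hi⟩
      · rw [hαβ.2 _ _ hi] at hu
        exact absurd hu (by simp)
      · rw [hαβ.2 _ _ hi] at hv
        exact absurd hv (by simp)
    | through huv₂ huv₂' hu₂ hv₂ h' =>
      obtain ⟨rfl, rfl⟩ := huv.unique huv₂
      obtain ⟨hκ, rfl, heq⟩ := ih h' (hαβ.hook huv.ne)
      obtain rfl : κ = κ' := by omega
      obtain ⟨rfl, rfl⟩ := huv'.unique huv₂'
      exact ⟨rfl, rfl, hook_injective heq (hu.trans hu₂.symm)⟩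

theorem hooked {k κ : ℕ} {b : Bool} {α : Brauer n} (h : Admissible w k κ b α)
    {u v : Fin n} (huv : IsBlock k u v) : ∃ κ' b',
    Admissible w (k + 1) κ' b' (hook u v α) := by
  cases h with
  | base => exact absurd huv.le (by omega)
  | circle huv' hc h' =>
    obtain ⟨rfl, rfl⟩ := huv.unique huv'
    exact ⟨_, _, by rwa [hook_eq_self hc]⟩
  | absorb huv' _ _ h' =>
    obtain ⟨rfl, rfl⟩ := huv.unique huv'
    exact ⟨_, _, h'⟩
  | through huv' _ _ _ h' =>
    obtain ⟨rfl, rfl⟩ := huv.unique huv'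
    exact ⟨_, _, h'⟩

end Admissible

/-- The counterpart of `hook_injective`: the hook can be undone with any prescribed partner `y` of
`u`, by conjugating with the transposition of `v` and `y`. -/
theorem exists_hook_eq {u v : Fin n} {α : Brauer n} (h : α.partner (.inl u) = .inl v) {y : Pin n}
    (hy : y ≠ .inl u) : ∃ β : Brauer n, β.partner (.inl u) = y ∧ hook u v β = α := by
  have huv : (Sum.inl u : Pin n) ≠ .inl v := (ne_of_partner_eq h).symm
  let β : Brauer n :=
    { partner p := Equiv.swap (.inl v) y (α.partner (Equiv.swap (.inl v) y p))
      partner_partner p := by simp [α.partner_partner]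
      partner_ne p h := by
        rw [← Equiv.eq_symm_apply, Equiv.symm_swap] at h
        exact α.partner_ne _ h }
  have hβ : ∀ p, β.partner p = Equiv.swap (.inl v) y (α.partner (Equiv.swap (.inl v) y p)) :=
    fun p => rfl
  have hu : β.partner (.inl u) = y := by
    rw [hβ, Equiv.swap_apply_of_ne_of_ne huv hy.symm, h, Equiv.swap_apply_left]
  refine ⟨β, hu, ?_⟩
  ext1
  funext p
  simp [hook_partner, hu, hβ]

/-- Both hooks are conjugations by the same transposition, which permutes the left pins among
themselves. -/
theorem leftLE_of_hook_of_arc {u v i : Fin n} {α β : Brauer n}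
    (h : LeftLE (hook u v α) (hook u v β)) (hα : α.partner (.inl u) = .inl i)
    (hβ : β.partner (.inl u) = .inl i) : LeftLE α β := by
  have hs : ∀ a : Fin n, ∃ c : Fin n,
      Equiv.swap (Sum.inl v : Pin n) (.inl i) (.inl a) = .inl c := by
    intro a
    rw [Equiv.swap_apply_def]
    split_ifs
    exacts [⟨_, rfl⟩, ⟨_, rfl⟩, ⟨_, rfl⟩]
  have hp : ∀ γ : Brauer n, γ.partner (.inl u) = .inl i → ∀ p q, γ.partner p = q ↔
      (hook u v γ).partner (Equiv.swap (.inl v) (.inl i) p) = Equiv.swap (.inl v) (.inl i) q := by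
    intro γ hγ p q
    rw [hook_partner, hγ]
    simp
  intro a b hab
  obtain ⟨c, hc⟩ := hs a
  obtain ⟨d, hd⟩ := hs b
  rw [hp α hα, hc, hd] at hab
  rw [hp β hβ, hc, hd]
  exact h _ _ hab

/-- When `u` and `v` lie on lines, the arc between them is the only left arc that the hook adds. -/
theorem leftLE_of_hook_of_line {u v a b a' b' : Fin n} {α β : Brauer n}
    (h : LeftLE (hook u v α) (hook u v β))
    (hα : α.partner (.inl u) = .inr a) (hα' : α.partner (.inl v) = .inr b)
    (hβ : β.partner (.inl u) = .inr a') (hβ' : β.partner (.inl v) = .inr b') : LeftLE α β := by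
  intro i j hij
  have hne : ∀ {γ : Brauer n} {p q : Pin n} {c : Fin n}, γ.partner (.inl c) = q → q.isRight →
      p.isLeft → γ.partner (.inl c) ≠ p := by
    rintro γ p q c rfl h1 h2 rfl
    rw [← Sum.not_isRight] at h2
    exact h2 h1
  have hiu : i ≠ u := by rintro rfl; rw [hα] at hij; exact Sum.inr_ne_inl hij
  have hiv : i ≠ v := by rintro rfl; rw [hα'] at hij; exact Sum.inr_ne_inl hij
  have hiu' : (Sum.inl i : Pin n) ≠ .inl u := by simpa using hiu
  have hiv' : (Sum.inl i : Pin n) ≠ .inl v := by simpa using hiv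
  have key : ∀ {γ : Brauer n} {c d : Fin n}, γ.partner (.inl u) = .inr c →
      γ.partner (.inl v) = .inr d → (hook u v γ).partner (.inl i) = γ.partner (.inl i) := by
    intro γ c d hc hd
    refine hook_of_ne hiu' hiv' ?_ ?_
    · intro h'; rw [partner_eq_comm, hc] at h'; exact Sum.inr_ne_inl h'
    · intro h'; rw [partner_eq_comm, hd] at h'; exact Sum.inr_ne_inl h'
  rw [← key hα hα'] at hij
  rw [← key hβ hβ']
  exact h _ _ hij

namespace Admissible

/-- A representative of the hooked class is constructed by recursion on the number of remaining
pairs, and the hook is then undone: along the arc that `α` prescribes, or, if the pair lies on two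
lines, along the lines that the flag prescribes. -/
theorem exists_leftEq (w : Bool) {k : ℕ} (hk : 2 * k ≤ n) {α : Brauer n} (h : LeftCapped k α) :
    ∃ κ b β, Admissible w k κ b β ∧ LeftEq β α := by
  obtain ⟨d, hd⟩ : ∃ d, k + d = n / 2 := ⟨n / 2 - k, by omega⟩
  induction d generalizing k α with
  | zero =>
    refine ⟨_, _, _, .base hk (by omega), (h.leftEq_cap hk fun i j hi hij hj => ?_).symm⟩
    have := Fin.lt_def.1 hij
    omega
  | succ d ih =>
    obtain ⟨u, v, huv⟩ := exists_isBlock (n := n) (k := k) (by omega)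
    by_cases hc : α.partner (.inl u) = .inl v
    · obtain ⟨κ, b, β, hβ, heq⟩ := ih (by omega) (h.succ huv hc) (by omega)
      exact ⟨κ, b, β, .circle huv (heq.2 _ _ hc) hβ, heq⟩
    obtain ⟨κ, b, γ, hγ, heq⟩ := ih (by omega) (h.hook huv) (by omega)
    have hγu : γ.partner (.inl u) = .inl v := heq.2 _ _ (hook_left huv.ne α)
    rcases hu : α.partner (.inl u) with i | i
    · obtain ⟨β, hβ, rfl⟩ := exists_hook_eq hγu (y := .inl i) (hu ▸ α.partner_ne _)
      refine ⟨κ, _, β, .absorb huv ?_ (.inl ⟨i, hβ⟩) hγ,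
        leftLE_of_hook_of_arc heq.1 hβ hu, leftLE_of_hook_of_arc heq.2 hu hβ⟩
      rwa [hβ, ← hu]
    rcases hv : α.partner (.inl v) with j | j
    · obtain ⟨β, hβ, rfl⟩ := exists_hook_eq (partner_eq_comm.1 hγu) (y := .inl j)
        (hv ▸ α.partner_ne _)
      rw [hook_comm huv.ne α] at heq
      have hle := leftLE_of_hook_of_arc heq.1 hβ hv
      refine ⟨κ, _, β, .absorb huv ?_ (.inr ⟨j, hβ⟩) (by rwa [hook_comm huv.ne]),
        hle, leftLE_of_hook_of_arc heq.2 hv hβ⟩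
      intro h'
      exact hc (hle _ _ h')
    · obtain ⟨κ, rfl⟩ : ∃ κ', κ = κ' + 1 := ⟨κ - 1, by have := hγ.le; omega⟩
      obtain ⟨u', v', huv'⟩ := exists_isBlock (n := n) (k := κ) (by
        have := hγ.rightCapped.le; omega)
      have hγ' := hγ.rightCapped.arc κ (by omega) u' v' huv'
      -- The right arc at block `κ` is opened; the flag decides which of its ends is given to `u`,
      -- and the other one goes to `v`.
      have hγc : γ.partner (.inr (cond b v' u')) = .inr (cond b u' v') := by
        cases b
        · exact hγ'
        · exact partner_eq_comm.1 hγ'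
      obtain ⟨β, hβ, rfl⟩ := exists_hook_eq hγu (y := .inr (cond b v' u')) (by simp)
      have hβv : β.partner (.inl v) = .inr (cond b u' v') := by
        rw [← hγc, hook_of_partner_left huv.ne (partner_eq_comm.1 hβ)]
      exact ⟨κ, b, β, .through huv huv' hβ hβv hγ, leftLE_of_hook_of_line heq.1 hβ hβv hu hv,
        leftLE_of_hook_of_line heq.2 hu hv hβ hβv⟩

/-- Arcs of `α` survive in the product, so only a pair on two lines of `α` needs work. Its lines end
at the pair `κ`, and what `cap κ * β` does there decides the case of the product. The two hooks
match, since `hook u v α * β = hook u v (α * β)` and `cap (κ + 1) * β` is the hook of `cap κ * β`.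
The flags add. -/
theorem mul {w : Bool} {k κ : ℕ} {b : Bool} {α : Brauer n} (h : Admissible w k κ b α)
    {β : Brauer n} {l : ℕ} {c : Bool} (h' : Admissible w κ l c (cap κ * β)) :
    Admissible w k l (b ^^ c) (α * β) := by
  induction h generalizing l c with
  | base => simpa using h'
  | circle huv hc _ ih => exact .circle huv (mul_left_arc _ hc) (ih h')
  | @absorb k κ b α u v huv hne hl _ ih =>
    have h1 := ih h'
    rw [hook_mul huv.ne] at h1
    rw [Bool.xor_right_comm]
    refine .absorb huv ?_ ?_ h1
    · intro h2
      rcases hl with ⟨i, hi⟩ | ⟨i, hi⟩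
      · rw [mul_left_arc β hi] at h2
        exact hne (hi.trans h2)
      · have h3 := mul_left_arc β hi
        rw [partner_eq_comm.1 h2] at h3
        exact hne (partner_eq_comm.1 (hi.trans h3.symm))
    · rcases hl with ⟨i, hi⟩ | ⟨i, hi⟩
      exacts [.inl ⟨i, mul_left_arc β hi⟩, .inr ⟨i, mul_left_arc β hi⟩]
  | @through k κ b α u v u' v' huv huv' hu hv h ih =>
    have hα : RightCapped κ α := (Admissible.through huv huv' hu hv h).rightCapped
    have hmul : α * β = α * (cap κ * β) := by rw [← mul_assoc, hα.mul_cap]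
    have hlc : LeftCapped κ (cap κ * β) := (leftCapped_cap κ hα.le).mul_right β
    have hhook : hook u v α * β = hook u v (α * β) := hook_mul huv.ne α β
    have hcap := cap_succ_mul huv' β
    rw [hhook] at ih
    -- An arc of `cap κ * β` that starts at the end of a line of `α` avoids the last `κ` pairs, so
    -- its other end is also the end of a line of `α`, and the arc is pulled back.
    have harc : ∀ {x x' y' : Fin n}, α.partner (.inl x) = .inr x' →
        (cap κ * β).partner (.inl x') = .inl y' → ∃ y, α.partner (.inl y) = .inr y' ∧
          (α * β).partner (.inl x) = .inl y := by
      intro x x' y' hx hxy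
      obtain ⟨y, hy⟩ := hα.line y'
        (hlc.val_lt hα.le (hα.val_lt_of_line (partner_eq_comm.1 hx)) hxy)
      rw [partner_eq_comm] at hy
      exact ⟨y, hy, hmul ▸ mul_line_arc hx hxy hy⟩
    have huniq : ∀ {x y z : Fin n}, α.partner (.inl x) = .inr z → α.partner (.inl y) = .inr z →
        x = y := fun hx hy => Sum.inl.inj (α.partner_injective (hx.trans hy.symm))
    generalize cap κ * β = B at h' hmul hlc harc hcap
    cases h' with
    | base => exact absurd huv'.le (by omega)
    | circle huv₂ hc h2 =>
      obtain ⟨rfl, rfl⟩ := huv₂.unique huv'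
      have hc' : B.partner (.inl (cond b v' u')) = .inl (cond b u' v') := by
        cases b
        · exact hc
        · exact partner_eq_comm.1 hc
      obtain ⟨y, hy, hy'⟩ := harc hu hc'
      have hkey : (α * β).partner (.inl u) = .inl v := by rw [hy', huniq hy hv]
      have h3 := ih (c := c) (l := l) (by rwa [hcap, hook_eq_self hc])
      rw [hook_eq_self hkey] at h3
      exact .circle huv hkey h3
    | absorb huv₂ hne hl h2 =>
      obtain ⟨rfl, rfl⟩ := huv₂.unique huv'
      have hl' : (∃ i, B.partner (.inl (cond b v' u')) = .inl i) ∨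
          ∃ i, B.partner (.inl (cond b u' v')) = .inl i := by
        cases b
        · exact hl
        · exact hl.symm
      have hne' : B.partner (.inl (cond b v' u')) ≠ .inl (cond b u' v') := by
        cases b
        · exact hne
        · exact fun h' => hne (partner_eq_comm.1 h')
      rw [← Bool.xor_assoc]
      rw [← hcap] at h2
      refine .absorb huv ?_ ?_ (ih h2)
      · intro h3
        rcases hl' with ⟨i, hi⟩ | ⟨i, hi⟩
        · obtain ⟨y, hy, hy'⟩ := harc hu hi
          have : y = v := Sum.inl.inj (hy'.symm.trans h3)
          subst this
          rw [Sum.inr.inj (hy.symm.trans hv)] at hi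
          exact hne' hi
        · obtain ⟨y, hy, hy'⟩ := harc hv hi
          have : y = u := Sum.inl.inj (hy'.symm.trans (partner_eq_comm.1 h3))
          subst this
          rw [Sum.inr.inj (hy.symm.trans hu)] at hi
          exact hne' (partner_eq_comm.1 hi)
      · rcases hl' with ⟨i, hi⟩ | ⟨i, hi⟩
        · obtain ⟨y, -, hy⟩ := harc hu hi
          exact .inl ⟨y, hy⟩
        · obtain ⟨y, -, hy⟩ := harc hv hi
          exact .inr ⟨y, hy⟩
    | @through _ _ _ _ _ _ u₂ v₂ huv₂ huv₂' hu₂ hv₂ h2 =>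
      obtain ⟨rfl, rfl⟩ := huv₂.unique huv'
      rw [← hcap] at h2
      refine .through huv huv₂' ?_ ?_ (ih h2)
      · rw [hmul]
        refine mul_line_line hu ?_
        cases b
        · simpa using hu₂
        · simpa using hv₂
      · rw [hmul]
        refine mul_line_line hv ?_
        cases b
        · simpa using hv₂
        · simpa using hu₂

theorem cap_mul {w : Bool} {κ : ℕ} {b : Bool} {α : Brauer n} (h : Admissible w 0 κ b α) {k : ℕ}
    (hk : 2 * k ≤ n) : ∃ l c, Admissible w k l c (cap k * α) := by
  induction k with
  | zero => exact ⟨κ, b, by rwa [cap_zero, one_mul]⟩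
  | succ k ih =>
    obtain ⟨u, v, huv⟩ := exists_isBlock (n := n) (k := k) (by omega)
    obtain ⟨l, c, hlc⟩ := ih (by omega)
    rw [cap_succ_mul huv]
    exact hlc.hooked huv

theorem cap_self {w : Bool} {k : ℕ} (hk : 2 * k ≤ n) :
    Admissible w k k false (cap k : Brauer n) := by
  obtain ⟨d, hd⟩ : ∃ d, k + d = n / 2 := ⟨n / 2 - k, by omega⟩
  induction d generalizing k with
  | zero => exact .base hk (by omega)
  | succ d ih =>
    obtain ⟨u, v, huv⟩ := exists_isBlock (n := n) (k := k) (by omega)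
    refine .through huv huv ?_ ?_ (cap_succ huv ▸ ih (by omega) (by omega))
    · exact cap_line k hk u (by have := huv.fst; omega)
    · exact cap_line k hk v (by have := huv.snd; omega)

/-- The cases `circle` and `absorb` would leave `k + 1 ≤ k`. Hence all pairs go through, and nothing
changes the initial flag. -/
theorem eq_false_of_self {w : Bool} {k : ℕ} {b : Bool} {α : Brauer n}
    (h : Admissible w k k b α) : b = false := by
  obtain ⟨d, hd⟩ : ∃ d, k + d = n / 2 := ⟨n / 2 - k, by have := h.two_mul_le; omega⟩
  induction d generalizing k α with
  | zero =>
    cases h with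
    | base => rfl
    | circle huv => exact absurd huv.le (by omega)
    | absorb huv => exact absurd huv.le (by omega)
    | through huv => exact absurd huv.le (by omega)
  | succ d ih =>
    cases h with
    | base => rfl
    | circle _ _ h => exact absurd h.le (by omega)
    | absorb _ _ _ h => exact absurd h.le (by omega)
    | through _ _ _ _ h => exact ih h (by omega)

end Admissible

/-- The canonical cross-section of the Brauer monoid in which the parameters of the elements of
corank two are `w`, except for those that join the two pins of a block. -/
def crossSection (n : ℕ) (w : Bool) : Subsemigroup (Brauer n) where
  carrier := {α | ∃ κ b, Admissible w 0 κ b α}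
  mul_mem' := by
    rintro α β ⟨κ, b, hα⟩ ⟨l, c, hβ⟩
    obtain ⟨l', c', h⟩ := hβ.cap_mul hα.rightCapped.le
    exact ⟨_, _, hα.mul h⟩

theorem crossSection_eq_of_leftEq {w : Bool} {α β : Brauer n} (hα : α ∈ crossSection n w)
    (hβ : β ∈ crossSection n w) (h : LeftEq α β) : α = β := by
  obtain ⟨_, _, hα⟩ := hα
  obtain ⟨_, _, hβ⟩ := hβ
  exact (hα.eq_of_leftEq hβ h).2.2

theorem exists_mem_crossSection (w : Bool) (α : Brauer n) :
    ∃ β ∈ crossSection n w, LeftEq β α := by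
  obtain ⟨κ, b, β, hβ, h⟩ := Admissible.exists_leftEq w (k := 0) (by omega)
    (α := α) (fun t ht => by omega)
  exact ⟨β, ⟨κ, b, hβ⟩, h⟩

theorem isCanonical_crossSection (n : ℕ) (w : Bool) : IsCanonical (crossSection n w) := by
  refine ⟨fun α => ?_, ?_⟩
  · obtain ⟨β, hβ, h⟩ := exists_mem_crossSection w α
    refine ⟨β, ⟨hβ, greenR_iff_leftEq.2 h.symm⟩, ?_⟩
    rintro γ ⟨hγ, h'⟩
    exact crossSection_eq_of_leftEq hγ hβ ((h.trans (greenR_iff_leftEq.1 h')).symm)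
  · rintro α ⟨κ, b, h⟩
    exact canonical_iff_rightCapped.2 ⟨κ, h.rightCapped⟩

/-! ### Chips of corank two -/

theorem corank_eq_two_iff {α : Brauer n} {i j : Fin n} (h : α.partner (.inl i) = .inl j) :
    α.corank = 2 ↔ ∀ a, a ≠ i → a ≠ j → ∃ c, α.partner (.inl a) = .inr c := by
  classical
  have hij : i ≠ j := by rintro rfl; exact α.partner_ne _ h
  have hcard : (Finset.univ \ {i, j} : Finset (Fin n)).card = n - 2 := by
    rw [Finset.card_sdiff_of_subset (Finset.subset_univ _), Finset.card_univ, Fintype.card_fin,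
      Finset.card_pair hij]
  have hn : 2 ≤ n := by
    have := Finset.card_le_univ ({i, j} : Finset (Fin n))
    rwa [Finset.card_pair hij, Fintype.card_fin] at this
  have hsub : (Finset.univ.filter fun a : Fin n => (α.partner (Sum.inl a)).isRight = true) ⊆
      Finset.univ \ {i, j} := by
    intro a ha
    simp only [Finset.mem_filter, Finset.mem_univ, true_and, Finset.mem_sdiff, Finset.mem_insert,
      Finset.mem_singleton, not_or] at ha ⊢
    constructor
    · rintro rfl; rw [h] at ha; simp at ha
    · rintro rfl; rw [partner_eq_comm.1 h] at ha; simp at ha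
  have hle := Finset.card_le_card hsub
  rw [hcard] at hle
  constructor
  · intro hc a hai haj
    have heq := Finset.eq_of_subset_of_card_le hsub (by
      rw [hcard]
      rw [corank, rank] at hc
      omega)
    have : a ∈ Finset.univ \ {i, j} := by simp [hai, haj]
    rw [← heq] at this
    simpa [Sum.isRight_iff] using this
  · intro hl
    have heq : (Finset.univ.filter fun a : Fin n => (α.partner (Sum.inl a)).isRight = true) =
        Finset.univ \ {i, j} := by
      refine hsub.antisymm fun a ha => ?_
      simp only [Finset.mem_sdiff, Finset.mem_univ, Finset.mem_insert, Finset.mem_singleton,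
        not_or, true_and] at ha
      simpa [Sum.isRight_iff] using hl a ha.1 ha.2
    rw [corank, rank, heq, hcard]
    omega

theorem corank_hook_one {i j : Fin n} (hij : i ≠ j) : (hook i j (1 : Brauer n)).corank = 2 := by
  rw [corank_eq_two_iff (hook_left hij 1)]
  intro a hi hj
  refine ⟨a, ?_⟩
  rw [hook_of_ne] <;> simp [one_partner, hi, hj]

theorem cap_mul_pair_line {α : Brauer n} {i j : Fin n} (hαij : α.partner (.inl i) = .inl j)
    (hc : α.corank = 2) {k : ℕ} {a : Fin n} (hk : 2 * k ≤ n) (ha : a.val + 2 * k < n) (hai : a ≠ i)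
    (haj : a ≠ j) :
    ∃ c, α.partner (.inl a) = .inr c ∧ (cap k * α).partner (.inl a) = .inr c := by
  obtain ⟨c, hc⟩ := (corank_eq_two_iff hαij).1 hc a hai haj
  exact ⟨c, hc, mul_line_line (cap_line k hk a ha) hc⟩

theorem cap_mul_pair_arc {α : Brauer n} {i j : Fin n} (hαij : α.partner (.inl i) = .inl j)
    {k : ℕ} (hk : 2 * k ≤ n) (hij : i < j) (hj : j.val + 2 * k < n) :
    (cap k * α).partner (.inl i) = .inl j :=
  mul_line_arc (cap_line k hk i (by have := Fin.lt_def.1 hij; omega)) hαij (cap_line k hk j hj)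

/-- Outside of the last `k` pairs, every left pin of `cap k * α` other than `i` lies on a line. One
pin alone cannot form an arc there. -/
theorem leftEq_cap_of_pair {α : Brauer n} {i j : Fin n} (hαij : α.partner (.inl i) = .inl j)
    (hc : α.corank = 2) {k : ℕ} (hk : 2 * k ≤ n) (hj : n ≤ j.val + 2 * k) :
    LeftEq (cap k * α) (cap k) := by
  refine ((leftCapped_cap k hk).mul_right α).leftEq_cap hk ?_
  intro a c ha hac hc' h'
  have hx : ∀ {x y : Fin n}, x.val + 2 * k < n → (cap k * α).partner (.inl x) = .inl y → x = i := by
    intro x y hx hxy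
    by_contra hxi
    obtain ⟨c, -, hc⟩ := cap_mul_pair_line hαij hc hk hx hxi (by rintro rfl; omega)
    rw [hxy] at hc
    exact Sum.inl_ne_inr hc
  rw [hx ha h', hx hc' (partner_eq_comm.1 h')] at hac
  exact lt_irrefl _ hac

/-- All parameters of the elements of corank two are `w` (the transposition if `w` is true), except
for the elements that join the two pins of a block, whose parameters are the identity. -/
def HasParam (w : Bool) (T : Subsemigroup (Brauer n)) : Prop :=
  ∀ i j : Fin n, i < j → ∀ α ∈ T, α.partner (.inl i) = .inl j → α.corank = 2 →
    ∀ l u v u' v', IsBlock l u v → IsBlock (l + 1) u' v' → j < u →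
      ((∃ t, IsBlock t i j) → α.partner (.inl v) = .inr v') ∧
      ((¬∃ t, IsBlock t i j) → α.partner (.inl v) = .inr (cond w u' v'))

theorem joinsLL_iff {α : Brauer n} {i j : Fin n} :
    α.JoinsLL (i.val + 1) (j.val + 1) ↔ α.partner (.inl i) = .inl j := by
  constructor
  · rintro ⟨a, b, ha, hb, h⟩
    obtain rfl : a = i := Fin.ext (by omega)
    obtain rfl : b = j := Fin.ext (by omega)
    exact h
  · exact fun h => ⟨i, j, rfl, rfl, h⟩

theorem joinsLR_iff {α : Brauer n} {i j : Fin n} {a b : ℕ} (ha : i.val + 1 = a)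
    (hb : j.val + 1 = b) : α.JoinsLR a b ↔ α.partner (.inl i) = .inr j := by
  subst ha hb
  constructor
  · rintro ⟨a, b, ha, hb, h⟩
    obtain rfl : a = i := Fin.ext (by omega)
    obtain rfl : b = j := Fin.ext (by omega)
    exact h
  · exact fun h => ⟨i, j, rfl, rfl, h⟩

/-- The bound on `j` excludes the last block, which is not in `pairSet`. -/
theorem mem_pairSet_iff {i j : Fin n} (hj : j.val + 1 < n - 1) :
    (i.val + 1, j.val + 1) ∈ pairSet n ↔ ∃ t, IsBlock t i j := by
  simp only [pairSet, Set.mem_ofPred_eq]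
  constructor
  · rintro ⟨-, h1, m, hm, h2⟩
    exact ⟨m, by omega, by omega⟩
  · rintro ⟨t, h1, h2⟩
    exact ⟨by omega, by omega, t, by omega, by omega⟩

/-- The parameters in terms of pins. -/
theorem params_iff (w : Bool) (T : Subsemigroup (Brauer n)) :
    (∀ i j : ℕ, 1 ≤ i → i < j → j < n - 1 → ∀ α ∈ T, α.corank = 2 → α.JoinsLL i j →
      ∀ l, 1 ≤ l → l ≤ (n - j) / 2 →
      ((i, j) ∉ pairSet n → (cond w (α.ParamSwap l) (α.ParamId l))) ∧
      ((i, j) ∈ pairSet n → α.ParamId l)) ↔ HasParam w T := by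
  constructor
  · intro h i j hij α hα hαij hc l u v u' v' huv huv' hju
    have h1 := huv.fst; have h2 := huv.snd; have h3 := huv'.fst; have h4 := huv'.snd
    have hij' := Fin.lt_def.1 hij
    have hju' := Fin.lt_def.1 hju
    -- The parameter with index `l + 1` describes the line from the second pin of block `l` on the
    -- left to block `l + 1` on the right.
    have := h (i.val + 1) (j.val + 1) (by omega) (by omega) (by omega) α hα hc
      (joinsLL_iff.2 hαij) (l + 1) (by omega) (by omega)
    rw [mem_pairSet_iff (by omega)] at this
    have hid : α.ParamId (l + 1) ↔ α.partner (.inl v) = .inr v' :=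
      joinsLR_iff (by omega) (by omega)
    have hswap : α.ParamSwap (l + 1) ↔ α.partner (.inl v) = .inr u' :=
      joinsLR_iff (by omega) (by omega)
    rw [hid, hswap] at this
    refine ⟨this.2, fun h' => ?_⟩
    have := this.1 h'
    cases w <;> exact this
  · rintro h i j hi hij hj α hα hc ⟨i, j, rfl, rfl, hαij⟩ l hl1 hl2
    obtain ⟨l, rfl⟩ : ∃ m, l = m + 1 := ⟨l - 1, by omega⟩
    obtain ⟨u, v, huv⟩ := exists_isBlock (n := n) (k := l) (by omega)
    obtain ⟨u', v', huv'⟩ := exists_isBlock (n := n) (k := l + 1) (by omega)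
    have h1 := huv.fst; have h2 := huv.snd; have h3 := huv'.fst; have h4 := huv'.snd
    have := h i j (Fin.lt_def.2 (by omega)) α hα hαij hc l u v u' v' huv huv'
      (Fin.lt_def.2 (by omega))
    rw [mem_pairSet_iff (by omega)]
    have hid : α.ParamId (l + 1) ↔ α.partner (.inl v) = .inr v' :=
      joinsLR_iff (by omega) (by omega)
    have hswap : α.ParamSwap (l + 1) ↔ α.partner (.inl v) = .inr u' :=
      joinsLR_iff (by omega) (by omega)
    rw [hid, hswap]
    refine ⟨fun h' => ?_, this.1⟩
    have := this.2 h'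
    cases w <;> exact this

theorem isAlternating_iff (T : Subsemigroup (Brauer n)) :
    IsAlternating T ↔ IsCanonical T ∧ HasParam true T := by
  rw [← params_iff]
  rfl

theorem isRegular_iff (T : Subsemigroup (Brauer n)) :
    IsRegular T ↔ IsCanonical T ∧ HasParam false T := by
  rw [← params_iff, IsRegular]
  refine and_congr_right fun _ => ?_
  constructor
  · intro h i j hi hij hj α hα hc hαij l hl hl'
    have := h i j hi hij hj α hα hc hαij l hl hl'
    exact ⟨fun _ => this, fun _ => this⟩
  · intro h i j hi hij hj α hα hc hαij l hl hl'
    have := h i j hi hij hj α hα hc hαij l hl hl'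
    by_cases h' : (i, j) ∈ pairSet n
    exacts [this.2 h', this.1 h']

/-- The parameters of an admissible chip whose only left arc, apart from the last `k` pairs, joins
`i` and `j`. -/
theorem Admissible.params {w : Bool} {k : ℕ} {b : Bool} {α : Brauer n}
    (h : Admissible w k (k + 1) b α) {i j : Fin n} (hij : i < j) (hj : j.val + 2 * k < n)
    (hαij : α.partner (.inl i) = .inl j)
    (hl : ∀ a : Fin n, a.val + 2 * k < n → a ≠ i → a ≠ j → ∃ c, α.partner (.inl a) = .inr c) :
    (((∃ t, IsBlock t i j) → b = false) ∧ ((¬∃ t, IsBlock t i j) → b = w)) ∧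
    ∀ l u v u' v', k ≤ l → IsBlock l u v → IsBlock (l + 1) u' v' → j < u →
      α.partner (.inl v) = .inr (cond b u' v') := by
  obtain ⟨d, hd⟩ : ∃ d, k + d = n / 2 := ⟨n / 2 - k, by have := h.two_mul_le; omega⟩
  have hij' := Fin.lt_def.1 hij
  have harc : ∀ a c : Fin n, a.val + 2 * k < n → α.partner (.inl a) = .inl c → a = i ∨ a = j := by
    intro a c ha hac
    by_contra hne
    rw [not_or] at hne
    obtain ⟨c', hc'⟩ := hl a ha hne.1 hne.2
    rw [hac] at hc'
    exact Sum.inl_ne_inr hc'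
  induction d generalizing k α with
  | zero => have := h.le; have := h.rightCapped.le; omega
  | succ d ih =>
    cases h with
    | @circle _ _ _ _ u v huv hc h =>
      have h1 := huv.fst; have h2 := huv.snd
      -- There is one right arc more than there are capped pairs. The present pair accounts for it,
      -- so no later recursive step contributes to the flag.
      have hb := h.eq_false_of_self
      have hu : u = i := by
        refine (harc u v (by omega) hc).resolve_right ?_
        rintro rfl
        rw [partner_eq_comm, hc, Sum.inl.injEq] at hαij
        subst hαij; omega
      subst hu
      obtain rfl : v = j := Sum.inl.inj (hc.symm.trans hαij)
      refine ⟨⟨fun _ => hb, fun h' => absurd ⟨k, huv⟩ h'⟩, ?_⟩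
      intro l u' _ _ _ hkl huv' _ hlt
      have := huv'.fst; have := Fin.lt_def.1 hlt; omega
    | @absorb _ _ b _ u v huv hne hl' h =>
      have h1 := huv.fst; have h2 := huv.snd
      have hb := h.eq_false_of_self
      -- The pair meets the only arc. It contains the larger end `j`, because `i` lies before `j`
      -- and no pin after this pair is left over.
      have hju : j = u ∨ j = v := by
        by_contra hcon
        rw [not_or] at hcon
        have := val_lt_of_ne_isBlock huv hj hcon.1 hcon.2
        rcases hl' with ⟨c, hc⟩ | ⟨c, hc⟩
        · rcases harc u c (by omega) hc with rfl | rfl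
          · omega
          · exact hcon.1 rfl
        · rcases harc v c (by omega) hc with rfl | rfl
          · omega
          · exact hcon.2 rfl
      refine ⟨⟨?_, fun _ => by rw [hb, Bool.false_xor]⟩, ?_⟩
      · rintro ⟨t, ht⟩
        have h3 := ht.fst; have h4 := ht.snd
        rcases hju with rfl | rfl
        · omega
        · obtain rfl : t = k := by omega
          obtain ⟨rfl, -⟩ := huv.unique ht
          exact absurd hαij hne
      · intro l u' _ _ _ hkl huv' _ hlt
        have := huv'.fst; have := Fin.lt_def.1 hlt
        rcases hju with rfl | rfl <;> omega
    | @through _ _ _ _ u v u₂ v₂ huv huv₂ hu hv h =>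
      have h1 := huv.fst; have h2 := huv.snd
      have hne : ∀ {a c : Fin n}, α.partner (.inl a) = .inr c → a ≠ i ∧ a ≠ j := by
        intro a c hac
        constructor
        · rintro rfl; rw [hαij] at hac; exact Sum.inl_ne_inr hac
        · rintro rfl; rw [partner_eq_comm.1 hαij] at hac; exact Sum.inl_ne_inr hac
      have hju := val_lt_of_ne_isBlock huv hj (hne hu).2.symm (hne hv).2.symm
      have hkeep : ∀ a, a ≠ u → a ≠ v →
          (hook u v α).partner (.inl a) = α.partner (.inl a) := by
        intro a hau hav
        refine hook_of_ne (by simpa using hau) (by simpa using hav) ?_ ?_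
        · intro h'; rw [partner_eq_comm, hu] at h'; exact Sum.inr_ne_inl h'
        · intro h'; rw [partner_eq_comm, hv] at h'; exact Sum.inr_ne_inl h'
      have hneuv : ∀ a : Fin n, a.val + 2 * (k + 1) < n → a ≠ u ∧ a ≠ v := by
        intro a ha
        constructor <;> (rintro rfl; omega)
      have hl'' : ∀ a : Fin n, a.val + 2 * (k + 1) < n → a ≠ i → a ≠ j →
          ∃ c, (hook u v α).partner (.inl a) = .inr c := by
        intro a ha hai haj
        rw [hkeep a (hneuv a ha).1 (hneuv a ha).2]
        exact hl a (by omega) hai haj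
      have hij'' : (hook u v α).partner (.inl i) = .inl j := by
        rw [hkeep i (hne hu).1.symm (hne hv).1.symm, hαij]
      obtain ⟨hb, hp⟩ := ih h hju hij'' hl'' (by omega) (by
        intro a c ha hac
        rw [hkeep a (hneuv a ha).1 (hneuv a ha).2] at hac
        exact harc a c (by omega) hac)
      refine ⟨hb, ?_⟩
      intro l u' v' u₃ v₃ hkl huv' huv₃ hlt
      rcases Nat.eq_or_lt_of_le hkl with rfl | hkl
      · obtain ⟨rfl, rfl⟩ := huv.unique huv'
        obtain ⟨rfl, rfl⟩ := huv₂.unique huv₃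
        exact hv
      · have := hp l u' v' u₃ v₃ hkl huv' huv₃ hlt
        have h3 := huv'.snd
        rwa [hkeep v' (by rintro rfl; omega) (by rintro rfl; omega)] at this

theorem hasParam_crossSection (n : ℕ) (w : Bool) : HasParam w (crossSection n w) := by
  rintro i j hij α ⟨κ, b, hα⟩ hαij hc l u v u' v' huv huv' hju
  obtain rfl : κ = 0 + 1 := by have := hα.rightCapped.corank; omega
  obtain ⟨hb, hp⟩ := hα.params hij (by omega) hαij
    fun a _ => (corank_eq_two_iff hαij).1 hc a
  have h := hp l u v u' v' (by omega) huv huv' hju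
  refine ⟨fun h' => ?_, fun h' => ?_⟩
  · rw [h, hb.1 h']; rfl
  · rw [h, hb.2 h']

/-! ### Uniqueness -/

theorem IsCanonical.exists_leftEq {T : Subsemigroup (Brauer n)} (hT : IsCanonical T)
    (α : Brauer n) : ∃ β ∈ T, LeftEq β α := by
  obtain ⟨β, ⟨hβ, h⟩, -⟩ := hT.1 α
  exact ⟨β, hβ, (greenR_iff_leftEq.1 h).symm⟩

theorem IsCanonical.eq_of_leftEq {T : Subsemigroup (Brauer n)} (hT : IsCanonical T)
    {α β : Brauer n} (hα : α ∈ T) (hβ : β ∈ T) (h : LeftEq α β) : α = β :=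
  (hT.1 α).unique ⟨hα, greenR_iff_leftEq.2 ⟨.refl _, .refl _⟩⟩ ⟨hβ, greenR_iff_leftEq.2 h⟩

/-- The representative `t` of the class of `cap k` is right capped, so `t * t` has the left arcs of
`t * cap k = t`, and `t` is idempotent. As `cap k` is a right multiple of `t`, it equals `t * cap
k`, which is `t`. -/
theorem IsCanonical.cap_mem {T : Subsemigroup (Brauer n)} (hT : IsCanonical T) {k : ℕ}
    (hk : 2 * k ≤ n) : cap k ∈ T := by
  obtain ⟨t, ht, hle⟩ := hT.exists_leftEq (cap k)
  obtain ⟨l, hl⟩ := canonical_iff_rightCapped.1 (hT.2 t ht)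
  obtain rfl : l = k := by
    have h1 := hl.corank
    have h2 := (rightCapped_cap (n := n) k hk).corank
    rw [hle.corank_eq] at h1
    omega
  have htt : t * t = t := by
    refine hT.eq_of_leftEq (T.mul_mem ht ht) ht ?_
    have := hle.mul_left t
    rwa [hl.mul_cap] at this
  obtain ⟨γ, hγ⟩ := exists_eq_mul_of_leftLE hle.1
  have : t * cap l = cap l := by
    conv_lhs => rw [hγ, ← mul_assoc, htt]
    exact hγ.symm
  rw [hl.mul_cap] at this
  rwa [← this]

/-- Pairs after `j` go through, and the parameters say how. At the pair that contains `j`, the chip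
`cap (k + 1)` absorbs `α`, which ends the recursion. -/
theorem admissible_cap_mul_of_hasParam {w : Bool} {T : Subsemigroup (Brauer n)}
    (hT : IsCanonical T) (hw : HasParam w T) {α : Brauer n} (hα : α ∈ T) {i j : Fin n} (hij : i < j)
    (hαij : α.partner (.inl i) = .inl j) (hc : α.corank = 2) {k : ℕ} (hj : j.val + 2 * k < n) :
    ∃ b, Admissible w k (k + 1) b (cap k * α) ∧ ((∃ t, IsBlock t i j) → b = false) ∧
      ((¬∃ t, IsBlock t i j) → b = w) := by
  obtain ⟨d, hd⟩ : ∃ d, k + d = n / 2 := ⟨n / 2 - k, by omega⟩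
  have hij' := Fin.lt_def.1 hij
  induction d generalizing k with
  | zero => omega
  | succ d ih =>
    obtain ⟨u, v, huv⟩ := exists_isBlock (n := n) (k := k) (by omega)
    obtain ⟨h1, h2⟩ := huv
    have huv : IsBlock k u v := ⟨h1, h2⟩
    have hAij := cap_mul_pair_arc hαij (k := k) (by omega) hij hj
    by_cases hju : j = u ∨ j = v
    · have hcap : cap (k + 1) * α = cap (k + 1) := by
        refine hT.eq_of_leftEq (T.mul_mem (hT.cap_mem (by omega)) hα) (hT.cap_mem (by omega)) ?_
        exact leftEq_cap_of_pair hαij hc (by omega) (by rcases hju with rfl | rfl <;> omega)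
      have hadm : Admissible w (k + 1) (k + 1) false (hook u v (cap k * α)) := by
        rw [← cap_succ_mul huv, hcap]
        exact .cap_self (by omega)
      by_cases hb : ∃ t, IsBlock t i j
      · obtain ⟨t, ht⟩ := id hb
        have h3 := ht.fst; have h4 := ht.snd
        have hjv : j = v := hju.resolve_left (by rintro rfl; omega)
        subst hjv
        obtain rfl : t = k := by omega
        obtain ⟨rfl, -⟩ := huv.unique ht
        rw [hook_eq_self hAij] at hadm
        exact ⟨false, .circle huv hAij hadm, fun _ => rfl, fun h => absurd hb h⟩
      · refine ⟨false ^^ w, .absorb huv ?_ ?_ hadm, fun h => absurd h hb,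
          fun _ => Bool.false_xor w⟩
        · intro h'
          rcases hju with rfl | rfl
          · rw [partner_eq_comm, h', Sum.inl.injEq] at hAij
            subst hAij; omega
          · rw [partner_eq_comm, partner_eq_comm.1 hAij, Sum.inl.injEq] at h'
            subst h'
            exact hb ⟨k, huv⟩
        · rcases hju with rfl | rfl
          exacts [.inl ⟨i, partner_eq_comm.1 hAij⟩, .inr ⟨i, partner_eq_comm.1 hAij⟩]
    · rw [not_or] at hju
      have hju' := val_lt_of_ne_isBlock huv hj hju.1 hju.2
      obtain ⟨b, hadm, hb⟩ := ih hju' (by omega)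
      obtain ⟨u', v', huv'⟩ := exists_isBlock (n := n) (k := k + 1) (by
        have := hadm.rightCapped.le; omega)
      refine ⟨b, ?_, hb⟩
      have hαv : α.partner (.inl v) = .inr (cond b u' v') := by
        have hp := hw i j hij α hα hαij hc k u v u' v' huv huv' (Fin.lt_def.2 (by omega))
        by_cases hbl : ∃ t, IsBlock t i j
        · rw [hb.1 hbl, hp.1 hbl]; rfl
        · rw [hb.2 hbl, hp.2 hbl]
      have hAv : (cap k * α).partner (.inl v) = .inr (cond b u' v') :=
        mul_line_line (cap_line k (by omega) v (by omega)) hαv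
      obtain ⟨c, -, hAu⟩ := cap_mul_pair_line hαij hc (k := k) (a := u) (by omega) (by omega)
        (by rintro rfl; omega) (by rintro rfl; omega)
      rw [cap_succ_mul huv] at hadm
      have hcv : (hook u v (cap k * α)).partner (.inr c) = .inr (cond b u' v') := by
        rw [hook_of_partner_left huv.ne (partner_eq_comm.1 hAu), hAv]
      have harc := hadm.rightCapped.arc (k + 1) (by omega) u' v' huv'
      -- The parameter fixes only the line of `v`. The line of `u` is forced, since the hook must
      -- join the two right ends into the block `k + 1`.
      have hcu : c = cond b v' u' := by
        rw [partner_eq_comm] at hcv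
        cases b
        · exact Sum.inr.inj (hcv.symm.trans (partner_eq_comm.1 harc))
        · exact Sum.inr.inj (hcv.symm.trans harc)
      exact .through huv huv' (hcu ▸ hAu) hAv hadm

theorem admissible_of_hasParam {w : Bool} {T : Subsemigroup (Brauer n)} (hT : IsCanonical T)
    (hw : HasParam w T) {k : ℕ} (hk : 2 * k ≤ n) {α : Brauer n} (hα : α ∈ T)
    (h : LeftCapped k α) : ∃ κ b, Admissible w k κ b α := by
  obtain ⟨d, hd⟩ : ∃ d, k + d = n / 2 := ⟨n / 2 - k, by omega⟩
  induction d generalizing k α with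
  | zero =>
    obtain rfl : α = cap k := hT.eq_of_leftEq hα (hT.cap_mem hk) (h.leftEq_cap hk
      fun i j hi hij hj => by have := Fin.lt_def.1 hij; omega)
    exact ⟨_, _, .cap_self hk⟩
  | succ d ih =>
    by_cases hex : ∃ i j : Fin n, i < j ∧ j.val + 2 * k < n ∧ α.partner (.inl i) = .inl j
    · obtain ⟨i, j, hij, hj, hαij⟩ := hex
      obtain ⟨σ, hσ, hσe⟩ := hT.exists_leftEq (hook i j 1)
      have hσij : σ.partner (.inl i) = .inl j := hσe.2 _ _ (hook_left hij.ne 1)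
      obtain ⟨b, hx, -⟩ := admissible_cap_mul_of_hasParam hT hw hσ hij hσij
        (hσe.corank_eq.trans (corank_hook_one hij.ne)) hj
      -- Since `hook i j 1` fixes `α` and equals `σ * δ`, the factor `σ` splits off. Replacing `δ *
      -- α` by its representative `β` keeps the class of the product, hence the product, as both
      -- sides lie in `T`.
      obtain ⟨δ, hδ⟩ := exists_eq_mul_of_leftLE hσe.1
      have hαx : α = cap k * σ * (δ * α) := by
        rw [mul_assoc, ← mul_assoc σ, ← hδ, hook_one_mul hij.ne, hook_eq_self hαij,
          h.cap_mul hk]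
      obtain ⟨β, hβ, hβe⟩ := hT.exists_leftEq (δ * α)
      have hαβ : α = cap k * σ * β := by
        refine hT.eq_of_leftEq hα (T.mul_mem (T.mul_mem (hT.cap_mem hk) hσ) hβ) ?_
        have := (hβe.mul_left (cap k * σ)).symm
        rwa [← hαx] at this
      have hk1 := hx.rightCapped.le
      obtain ⟨κ, c, hc⟩ := ih hk1 (T.mul_mem (hT.cap_mem hk1) hβ)
        ((leftCapped_cap (k + 1) hk1).mul_right β) (by omega)
      rw [hαβ]
      exact ⟨_, _, hx.mul hc⟩
    · obtain rfl : α = cap k := hT.eq_of_leftEq hα (hT.cap_mem hk) (h.leftEq_cap hk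
        fun i j hi hij hj hαij => hex ⟨i, j, hij, hj, hαij⟩)
      exact ⟨_, _, .cap_self hk⟩

theorem eq_crossSection {w : Bool} {T : Subsemigroup (Brauer n)} (hT : IsCanonical T)
    (hw : HasParam w T) : T = crossSection n w := by
  have hle : T ≤ crossSection n w := fun α hα =>
    admissible_of_hasParam hT hw (k := 0) (by omega) hα fun t ht => by omega
  refine le_antisymm hle fun α hα => ?_
  obtain ⟨β, hβ, h⟩ := hT.exists_leftEq α
  rwa [← crossSection_eq_of_leftEq (hle hβ) hα h]

theorem isRegular_iff_eq {T : Subsemigroup (Brauer n)} :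
    IsRegular T ↔ T = crossSection n false := by
  rw [isRegular_iff]
  refine ⟨fun h => eq_crossSection h.1 h.2, ?_⟩
  rintro rfl
  exact ⟨isCanonical_crossSection n _, hasParam_crossSection n _⟩

theorem isAlternating_iff_eq {T : Subsemigroup (Brauer n)} :
    IsAlternating T ↔ T = crossSection n true := by
  rw [isAlternating_iff]
  refine ⟨fun h => eq_crossSection h.1 h.2, ?_⟩
  rintro rfl
  exact ⟨isCanonical_crossSection n _, hasParam_crossSection n _⟩

end Brauer

/-! ### A property of semigroups that tells the two cross-sections apart -/

section Distinguishing

variable {M N : Type*} [Mul M] [Mul N]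

/-- The element `a` is a right multiple of `b`. -/
def IsRightMultiple (a b : M) : Prop := ∃ c, a = b * c

/-- The only elements different from `e` with the right multiple `a ≠ e` are those equal to `a`. -/
def IsRightAtom (e a : M) : Prop := a ≠ e ∧ ∀ b, IsRightMultiple a b → b = e ∨ b = a

/-- All elements different from `e` absorb `a`. -/
def IsAbsorbed (e a : M) : Prop := ∀ y, y ≠ e → y * a = y

/-- The element `a` is an atom which is absorbed by all elements that are neither `e` nor an atom,
but not by all elements other than `e`. -/
def IsSecondLevel (e a : M) : Prop :=
  IsRightAtom e a ∧ ¬IsAbsorbed e a ∧ ∀ y, y ≠ e → ¬IsRightAtom e y → y * a = y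

/-- There is an element `b` of the second level such that for every element `a` of the second level
suitable right multiples `b * z` and `a * z` are right multiples of one and the same `u`. -/
def HasCommonTargets (e : M) : Prop :=
  ∃ b, IsSecondLevel e b ∧ ∀ a, IsSecondLevel e a → ∃ z u x, IsRightAtom e z ∧ u ≠ e ∧
    IsAbsorbed e u ∧ IsRightAtom e x ∧ ¬IsAbsorbed e x ∧
    (∀ c, IsRightMultiple c u → ¬IsRightMultiple c x) ∧
    IsRightMultiple (b * z) u ∧ IsRightMultiple (a * z) u

variable (φ : M ≃* N)

/-- All the conditions above are built from products and equality, so isomorphisms transport them.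
-/
theorem isRightMultiple_map_iff (a b : M) :
    IsRightMultiple (φ a) (φ b) ↔ IsRightMultiple a b := by
  simp only [IsRightMultiple, φ.surjective.exists, ← map_mul, φ.injective.eq_iff]

theorem isRightAtom_map_iff (e a : M) : IsRightAtom (φ e) (φ a) ↔ IsRightAtom e a := by
  simp only [IsRightAtom, φ.surjective.forall, isRightMultiple_map_iff, φ.injective.eq_iff, ne_eq]

theorem isAbsorbed_map_iff (e a : M) : IsAbsorbed (φ e) (φ a) ↔ IsAbsorbed e a := by
  simp only [IsAbsorbed, φ.surjective.forall, ← map_mul, φ.injective.eq_iff, ne_eq]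

theorem isSecondLevel_map_iff (e a : M) : IsSecondLevel (φ e) (φ a) ↔ IsSecondLevel e a := by
  simp only [IsSecondLevel, φ.surjective.forall, ← map_mul, φ.injective.eq_iff, ne_eq,
    isRightAtom_map_iff, isAbsorbed_map_iff]

theorem hasCommonTargets_map_iff (e : M) : HasCommonTargets (φ e) ↔ HasCommonTargets e := by
  simp only [HasCommonTargets, φ.surjective.forall, φ.surjective.exists, ← map_mul,
    φ.injective.eq_iff, ne_eq, isRightAtom_map_iff, isAbsorbed_map_iff, isSecondLevel_map_iff,
    isRightMultiple_map_iff]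

end Distinguishing

/-! ### Atoms, absorption and the two cross-sections -/

namespace Brauer

variable {n : ℕ} {w : Bool}

theorem cap_mem_crossSection {k : ℕ} (hk : 2 * k ≤ n) : cap k ∈ crossSection n w :=
  (isCanonical_crossSection n w).cap_mem hk

/-- The identity of the cross-section. -/
def crossSectionOne (n : ℕ) (w : Bool) : crossSection n w :=
  ⟨1, cap_mem_crossSection (k := 0) (by omega)⟩

theorem crossSection_ext {a b : crossSection n w} (h : LeftEq a.1 b.1) : a = b :=
  Subtype.ext (crossSection_eq_of_leftEq a.2 b.2 h)

/-- A factor from the whole monoid may be replaced by the representative of its class without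
changing the class of the product. So divisibility in the cross-section agrees with divisibility in
the Brauer monoid. -/
theorem isRightMultiple_iff (a b : crossSection n w) : IsRightMultiple a b ↔ LeftLE b.1 a.1 := by
  constructor
  · rintro ⟨c, rfl⟩
    exact leftLE_mul _ _
  · intro h
    obtain ⟨γ, hγ⟩ := exists_eq_mul_of_leftLE h
    obtain ⟨c, hc, hcγ⟩ := exists_mem_crossSection w γ
    refine ⟨⟨c, hc⟩, crossSection_ext ?_⟩
    rw [hγ]
    exact (hcγ.mul_left b.1).symm

theorem ne_crossSectionOne_iff (a : crossSection n w) :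
    a ≠ crossSectionOne n w ↔ ∃ i j : Fin n, i < j ∧ a.1.partner (.inl i) = .inl j := by
  constructor
  · intro h
    by_contra hex
    refine h (crossSection_ext ?_)
    refine LeftCapped.leftEq_cap (k := 0) (by omega) (fun t ht => by omega) ?_
    exact fun i j _ hij _ h' => hex ⟨i, j, hij, h'⟩
  · rintro ⟨i, j, -, h⟩ rfl
    exact Sum.inr_ne_inl h

/-- The only left arc of `α` joins `i` and `j`, where `i < j`. -/
structure IsPair (α : Brauer n) (i j : Fin n) : Prop where
  lt : i < j
  arc : α.partner (.inl i) = .inl j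
  corank : α.corank = 2

theorem IsPair.val_lt {α : Brauer n} {i j : Fin n} (h : IsPair α i j) : i.val < j.val :=
  Fin.lt_def.1 h.lt

theorem IsPair.line {α : Brauer n} {i j : Fin n} (h : IsPair α i j) {a : Fin n} (hi : a ≠ i)
    (hj : a ≠ j) : ∃ c, α.partner (.inl a) = .inr c :=
  (corank_eq_two_iff h.arc).1 h.corank a hi hj

theorem IsPair.eq_or_eq {α : Brauer n} {i j : Fin n} (h : IsPair α i j) {a c : Fin n}
    (hac : α.partner (.inl a) = .inl c) : a = i ∧ c = j ∨ a = j ∧ c = i := by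
  by_cases hi : a = i
  · subst hi
    exact .inl ⟨rfl, Sum.inl.inj (hac.symm.trans h.arc)⟩
  by_cases hj : a = j
  · subst hj
    exact .inr ⟨rfl, Sum.inl.inj (hac.symm.trans (partner_eq_comm.1 h.arc))⟩
  obtain ⟨d, hd⟩ := h.line hi hj
  rw [hac] at hd
  exact absurd hd (by simp)

theorem exists_isPair (w : Bool) {i j : Fin n} (hij : i < j) :
    ∃ a : crossSection n w, IsPair a.1 i j := by
  obtain ⟨α, hα, h⟩ := exists_mem_crossSection w (hook i j 1)
  exact ⟨⟨α, hα⟩, hij, h.2 _ _ (hook_left hij.ne 1),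
    h.corank_eq.trans (corank_hook_one hij.ne)⟩

theorem IsPair.leftLE_iff {α β : Brauer n} {i j : Fin n} (h : IsPair α i j) :
    LeftLE α β ↔ β.partner (.inl i) = .inl j := by
  refine ⟨fun h' => h' _ _ h.arc, fun h' a c hac => ?_⟩
  rcases h.eq_or_eq hac with ⟨rfl, rfl⟩ | ⟨rfl, rfl⟩
  · exact h'
  · exact partner_eq_comm.1 h'

theorem isRightAtom_iff (a : crossSection n w) :
    IsRightAtom (crossSectionOne n w) a ↔ ∃ i j, IsPair a.1 i j := by
  constructor
  · rintro ⟨h1, h2⟩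
    obtain ⟨i, j, hij, h⟩ := (ne_crossSectionOne_iff a).1 h1
    obtain ⟨x, hx⟩ := exists_isPair w hij
    rcases h2 x ((isRightMultiple_iff _ _).2 (hx.leftLE_iff.2 h)) with rfl | rfl
    · exact absurd hx.arc Sum.inr_ne_inl
    · exact ⟨i, j, hx⟩
  · rintro ⟨i, j, h⟩
    refine ⟨(ne_crossSectionOne_iff a).2 ⟨i, j, h.lt, h.arc⟩, fun b hb => ?_⟩
    rw [isRightMultiple_iff] at hb
    by_contra hcon
    rw [not_or] at hcon
    obtain ⟨p, q, hpq, hb'⟩ := (ne_crossSectionOne_iff b).1 hcon.1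
    refine hcon.2 (crossSection_ext ⟨hb, h.leftLE_iff.2 ?_⟩)
    rcases h.eq_or_eq (hb _ _ hb') with ⟨rfl, rfl⟩ | ⟨rfl, rfl⟩
    · exact hb'
    · exact partner_eq_comm.1 hb'

theorem IsPair.cap_mul_eq_iff {a : crossSection n w} {i j : Fin n} (h : IsPair a.1 i j) {k : ℕ}
    (hk : 2 * k ≤ n) : cap k * a.1 = cap k ↔ n ≤ j.val + 2 * k := by
  constructor
  · intro h'
    by_contra hj
    have h1 := cap_mul_pair_arc h.arc hk h.lt (not_le.1 hj)
    rw [h', cap_line k hk i (by have := h.val_lt; omega)] at h1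
    exact Sum.inr_ne_inl h1
  · intro hj
    exact crossSection_eq_of_leftEq (mul_mem (cap_mem_crossSection hk) a.2)
      (cap_mem_crossSection hk) (leftEq_cap_of_pair h.arc h.corank hk hj)

theorem IsPair.mul_eq_self {a : crossSection n w} {i j : Fin n} (h : IsPair a.1 i j)
    {y : Brauer n} {κ : ℕ} (hy : RightCapped κ y) (hj : n ≤ j.val + 2 * κ) : y * a.1 = y := by
  rw [← hy.mul_cap, mul_assoc, (h.cap_mul_eq_iff hy.le).2 hj]

theorem exists_rightCapped (a : crossSection n w) : ∃ κ, RightCapped κ a.1 := by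
  obtain ⟨κ, b, h⟩ := a.2
  exact ⟨κ, h.rightCapped⟩

theorem one_le_of_ne_one {a : crossSection n w} (h : a ≠ crossSectionOne n w) {κ : ℕ}
    (hκ : RightCapped κ a.1) : 1 ≤ κ := by
  by_contra hlt
  obtain rfl : κ = 0 := by omega
  refine h (crossSection_ext ?_)
  have hrank : a.1.rank = n := by
    have h1 := hκ.corank
    have h2 : a.1.rank ≤ n := (Finset.card_le_univ _).trans (by simp)
    rw [corank] at h1
    omega
  have huniv := Finset.eq_univ_of_card _ (hrank.trans (Fintype.card_fin n).symm)
  refine LeftCapped.leftEq_cap (k := 0) (by omega) (fun t ht => by omega) ?_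
  intro i j _ _ _ hij
  have := (Finset.mem_filter.1 (huniv ▸ Finset.mem_univ i)).2
  rw [hij] at this
  simp at this

theorem two_le_of_not_isRightAtom {a : crossSection n w} (h : a ≠ crossSectionOne n w)
    (h' : ¬IsRightAtom (crossSectionOne n w) a) {κ : ℕ} (hκ : RightCapped κ a.1) : 2 ≤ κ := by
  by_contra hlt
  obtain rfl : κ = 1 := by have := one_le_of_ne_one h hκ; omega
  obtain ⟨i, j, hij, hp⟩ := (ne_crossSectionOne_iff a).1 h
  exact h' ((isRightAtom_iff a).2 ⟨i, j, hij, hp, hκ.corank⟩)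

/-- The chip `cap k` as an element of the cross-section. -/
def crossSectionCap (w : Bool) {k : ℕ} (hk : 2 * k ≤ n) : crossSection n w :=
  ⟨cap k, cap_mem_crossSection hk⟩

theorem crossSectionCap_ne_one {k : ℕ} (hk : 2 * k ≤ n) (h1 : 1 ≤ k) :
    crossSectionCap w hk ≠ crossSectionOne n w := by
  obtain ⟨u, v, huv⟩ := exists_isBlock (n := n) (k := 0) (by omega)
  exact (ne_crossSectionOne_iff _).2 ⟨u, v, Fin.lt_def.2 huv.val_lt,
    leftCapped_cap k hk 0 (by omega) u v huv⟩

/-- The element `cap 1` is the decisive test: every element other than the identity has the last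
pair of right pins joined, so it absorbs whatever `cap 1` absorbs. -/
theorem IsPair.isAbsorbed_iff {a : crossSection n w} {i j : Fin n} (h : IsPair a.1 i j) :
    IsAbsorbed (crossSectionOne n w) a ↔ n ≤ j.val + 2 := by
  have hn : 2 * 1 ≤ n := by have := h.val_lt; have := j.isLt; omega
  constructor
  · intro h'
    have := h' _ (crossSectionCap_ne_one hn le_rfl)
    exact (h.cap_mul_eq_iff hn).1 (congrArg Subtype.val this)
  · intro hj y hy
    obtain ⟨κ, hκ⟩ := exists_rightCapped y
    have := one_le_of_ne_one hy hκ
    exact Subtype.ext (h.mul_eq_self hκ (by omega))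

/-- Elements that are neither the identity nor atoms have at least two right arcs, so the test is
now `cap 2`. The larger end of the arc is thus in the second last pair. -/
theorem isSecondLevel_iff (hn : 4 ≤ n) (a : crossSection n w) :
    IsSecondLevel (crossSectionOne n w) a ↔
      ∃ i j, IsPair a.1 i j ∧ j.val + 2 < n ∧ n ≤ j.val + 4 := by
  have hn' : 2 * 2 ≤ n := hn
  constructor
  · rintro ⟨h1, h2, h3⟩
    obtain ⟨i, j, h⟩ := (isRightAtom_iff a).1 h1
    rw [h.isAbsorbed_iff, not_le] at h2
    refine ⟨i, j, h, h2, ?_⟩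
    have := h3 (crossSectionCap w hn') (crossSectionCap_ne_one hn' (by omega)) ?_
    · exact (h.cap_mul_eq_iff hn').1 (congrArg Subtype.val this)
    · rw [isRightAtom_iff]
      rintro ⟨p, q, hpq⟩
      have h4 := (rightCapped_cap (n := n) 2 hn').corank
      have h5 := hpq.corank
      change (cap 2 : Brauer n).corank = 2 at h5
      omega
  · rintro ⟨i, j, h, h1, h2⟩
    refine ⟨(isRightAtom_iff a).2 ⟨i, j, h⟩, by rw [h.isAbsorbed_iff]; omega, ?_⟩
    intro y hy hy'
    obtain ⟨κ, hκ⟩ := exists_rightCapped y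
    have := two_le_of_not_isRightAtom hy hy' hκ
    exact Subtype.ext (h.mul_eq_self hκ (by omega))

/-- The lines through the last two left pins of a chip whose only left arc joins `i` and `j`. -/
theorem IsPair.last_lines {a : crossSection n w} {i j u v u' v' : Fin n} (h : IsPair a.1 i j)
    (hj : j.val + 2 < n) (huv : IsBlock 0 u v) (huv' : IsBlock 1 u' v') : ∃ b,
    (((∃ t, IsBlock t i j) → b = false) ∧ ((¬∃ t, IsBlock t i j) → b = w)) ∧
    a.1.partner (.inl u) = .inr (cond b v' u') ∧ a.1.partner (.inl v) = .inr (cond b u' v') := by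
  obtain ⟨κ, b, ha⟩ := a.2
  obtain rfl : κ = 0 + 1 := by have := ha.rightCapped.corank; have := h.corank; omega
  refine ⟨b, (ha.params h.lt (by omega) h.arc fun a _ => h.line).1, ?_⟩
  have h1 := huv.fst; have h2 := huv.snd; have h3 := h.val_lt
  cases ha with
  | circle huv₂ hc =>
    obtain ⟨rfl, rfl⟩ := huv.unique huv₂
    rcases h.eq_or_eq hc with ⟨rfl, rfl⟩ | ⟨rfl, rfl⟩ <;> omega
  | absorb huv₂ _ hl =>
    obtain ⟨rfl, rfl⟩ := huv.unique huv₂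
    rcases hl with ⟨c, hc⟩ | ⟨c, hc⟩ <;>
      rcases h.eq_or_eq hc with ⟨rfl, rfl⟩ | ⟨rfl, rfl⟩ <;> omega
  | through huv₂ huv₂' hu hv =>
    obtain ⟨rfl, rfl⟩ := huv.unique huv₂
    obtain ⟨rfl, rfl⟩ := huv'.unique huv₂'
    exact ⟨hu, hv⟩

theorem hasCommonTargets_crossSection_false (hn : 6 ≤ n) :
    HasCommonTargets (crossSectionOne n false) := by
  obtain ⟨u₀, v₀, h₀⟩ := exists_isBlock (n := n) (k := 0) (by omega)
  obtain ⟨u₁, v₁, h₁⟩ := exists_isBlock (n := n) (k := 1) (by omega)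
  have e1 := h₀.fst; have e2 := h₀.snd; have e3 := h₁.fst; have e4 := h₁.snd
  obtain ⟨b, hb⟩ := exists_isPair false (Fin.lt_def.2 h₁.val_lt)
  refine ⟨b, (isSecondLevel_iff (by omega) b).2 ⟨u₁, v₁, hb, by omega, by omega⟩, ?_⟩
  intro a ha
  obtain ⟨i, j, ha, hj, hj'⟩ := (isSecondLevel_iff (by omega) a).1 ha
  have hlast : ∀ {c : crossSection n false} {p q : Fin n}, IsPair c.1 p q → q.val + 2 < n →
      c.1.partner (.inl v₀) = .inr v₁ := by
    intro c p q hc hq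
    obtain ⟨d, ⟨hd, hd'⟩, -, h⟩ := hc.last_lines hq h₀ h₁
    by_cases hp : ∃ t, IsBlock t p q
    · rw [h, hd hp]; rfl
    · rw [h, hd' hp]; rfl
  -- Since `cap 2` absorbs `c`, the pins before the last two pairs that are not on the arc lie on
  -- straight lines.
  have hfix : ∀ {c : crossSection n false} {p q r : Fin n}, IsPair c.1 p q → n ≤ q.val + 4 →
      r ≠ p → r.val + 4 < n → c.1.partner (.inl r) = .inr r := by
    intro c p q r hc hq hrp hr
    obtain ⟨d, hd, hd'⟩ := cap_mul_pair_line hc.arc hc.corank (k := 2) (by omega) hr hrp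
      (by rintro rfl; omega)
    rw [(hc.cap_mul_eq_iff (by omega)).2 hq, cap_line 2 (by omega) r hr] at hd'
    rw [hd, hd']
  -- One of the first two pins is off the arc of `a`. As `n ≥ 6`, it lies before the last two pairs,
  -- hence off the arc of `b` as well.
  obtain ⟨p, hp, hpi⟩ : ∃ p : Fin n, p.val ≤ 1 ∧ p ≠ i := by
    by_cases hi : i.val = 0
    · exact ⟨⟨1, by omega⟩, le_rfl, fun h => by simp [← h] at hi⟩
    · exact ⟨⟨0, by omega⟩, by simp, fun h => by simp [← h] at hi⟩
  -- The arc of `z` from `p` to `v₁` is pulled back along the straight line at `p` and the line from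
  -- `v₀` to `v₁`; the result is the arc of `y`. The arc of `x` joins the first two pins, so it
  -- shares the pin `p` and is incompatible with that of `y`.
  obtain ⟨z, hz⟩ := exists_isPair false (i := p) (j := v₁) (Fin.lt_def.2 (by omega))
  obtain ⟨y, hy⟩ := exists_isPair false (i := p) (j := v₀) (Fin.lt_def.2 (by omega))
  obtain ⟨x, hx⟩ := exists_isPair false (i := (⟨0, by omega⟩ : Fin n)) (j := ⟨1, by omega⟩)
    (Fin.lt_def.2 (by simp))
  have htarget : ∀ {c : crossSection n false} {q r : Fin n}, IsPair c.1 q r → r.val + 2 < n →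
      n ≤ r.val + 4 → p ≠ q → IsRightMultiple (c * z) y := by
    intro c q r hc hr hr' hpq
    rw [isRightMultiple_iff, hy.leftLE_iff]
    exact mul_line_arc (hfix hc hr' hpq (by omega)) hz.arc (hlast hc hr)
  refine ⟨z, y, x, (isRightAtom_iff z).2 ⟨_, _, hz⟩, ((isRightAtom_iff y).2 ⟨_, _, hy⟩).1,
    hy.isAbsorbed_iff.2 (by omega), (isRightAtom_iff x).2 ⟨_, _, hx⟩, ?_, ?_,
    htarget hb (by omega) (by omega) (by rintro rfl; omega), htarget ha hj hj' hpi⟩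
  · rw [hx.isAbsorbed_iff]
    simp only
    omega
  · intro c hcy hcx
    rw [isRightMultiple_iff, hy.leftLE_iff] at hcy
    rw [isRightMultiple_iff] at hcx
    have hne : ∀ {s t : Fin n}, c.1.partner (.inl s) = .inl t → p = s → t.val ≤ 1 → False := by
      rintro s t hst rfl ht
      rw [hcy, Sum.inl.injEq] at hst
      subst hst
      omega
    have h01 := hcx _ _ hx.arc
    by_cases hp0 : p.val = 0
    · exact hne h01 (Fin.ext hp0) le_rfl
    · exact hne (partner_eq_comm.1 h01) (Fin.ext (by simp only; omega)) (by simp)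

/-- Both `a` and `b` must send `p` and `q` to the two ends of the only arc of `z`. As they send `q`
to different ends, `b` sends `q` where `a` sends `p`. -/
theorem not_common_target {a b z : crossSection n w} {p q p₁ p₂ q₁ q₂ s t : Fin n}
    (hz : IsPair z.1 s t) (ha1 : RightCapped 1 a.1)
    (hb1 : RightCapped 1 b.1) (haz : (a * z).1.partner (.inl p) = .inl q)
    (hbz : (b * z).1.partner (.inl p) = .inl q) (hap : a.1.partner (.inl p) = .inr p₁)
    (haq : a.1.partner (.inl q) = .inr q₁) (hbp : b.1.partner (.inl p) = .inr p₂)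
    (hbq : b.1.partner (.inl q) = .inr q₂) (hq : q₁ ≠ q₂) : q₂ = p₁ := by
  have key : ∀ {c : crossSection n w} {p' q' : Fin n}, RightCapped 1 c.1 →
      (c * z).1.partner (.inl p) = .inl q → c.1.partner (.inl p) = .inr p' →
      c.1.partner (.inl q) = .inr q' → p' = s ∧ q' = t ∨ p' = t ∧ q' = s := by
    intro c p' q' hc hcz hcp hcq
    have hn := hc.le
    have hmul : (c * z).1 = c.1 * (cap 1 * z.1) := by
      rw [← mul_assoc, hc.mul_cap]; rfl
    rw [hmul] at hcz
    have hlc : LeftCapped 1 (cap 1 * z.1) := (leftCapped_cap 1 hn).mul_right _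
    have hp' := hc.val_lt_of_line (partner_eq_comm.1 hcp)
    have hq' := hc.val_lt_of_line (partner_eq_comm.1 hcq)
    have harc : (cap 1 * z.1).partner (.inl p') = .inl q' := by
      rcases hr : (cap 1 * z.1).partner (.inl p') with r | r
      · obtain ⟨y, hy⟩ := hc.line r (hlc.val_lt hn hp' hr)
        rw [partner_eq_comm] at hy
        have := mul_line_arc hcp hr hy
        rw [hcz, Sum.inl.injEq] at this
        subst this
        rw [hr, Sum.inr.inj (hy.symm.trans hcq)]
      · rw [mul_line_line hcp hr] at hcz
        exact absurd hcz (by simp)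
    have hmem : ∀ {x y : Fin n}, x.val + 2 * 1 < n → (cap 1 * z.1).partner (.inl x) = .inl y →
        x = s ∨ x = t := by
      intro x y hx hxy
      by_contra hcon
      rw [not_or] at hcon
      obtain ⟨d, -, hd⟩ := cap_mul_pair_line hz.arc hz.corank hn hx hcon.1 hcon.2
      rw [hxy] at hd
      exact Sum.inl_ne_inr hd
    have hne : p' ≠ q' := by rintro rfl; exact (cap 1 * z.1).partner_ne _ harc
    rcases hmem hp' harc with rfl | rfl <;> rcases hmem hq' (partner_eq_comm.1 harc) with rfl | rfl
    · exact absurd rfl hne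
    · exact .inl ⟨rfl, rfl⟩
    · exact .inr ⟨rfl, rfl⟩
    · exact absurd rfl hne
  rcases key ha1 haz hap haq with ⟨h1, h2⟩ | ⟨h1, h2⟩ <;>
    rcases key hb1 hbz hbp hbq with ⟨h3, h4⟩ | ⟨h3, h4⟩ <;> simp_all

theorem not_hasCommonTargets_crossSection_true (hn : 6 ≤ n) :
    ¬HasCommonTargets (crossSectionOne n true) := by
  obtain ⟨u₀, v₀, h₀⟩ := exists_isBlock (n := n) (k := 0) (by omega)
  obtain ⟨u₁, v₁, h₁⟩ := exists_isBlock (n := n) (k := 1) (by omega)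
  have e1 := h₀.fst; have e2 := h₀.snd; have e3 := h₁.fst; have e4 := h₁.snd
  rintro ⟨b, hb, hall⟩
  obtain ⟨i, j, hb, hj, hj'⟩ := (isSecondLevel_iff (by omega) b).1 hb
  obtain ⟨c, ⟨hc, hc'⟩, hbu, hbv⟩ := hb.last_lines hj h₀ h₁
  -- An opponent `a` with the opposite crossing is chosen: an arc that is not a block if the arc of
  -- `b` is one, and the second last block otherwise. From `n ≥ 6` it follows that the first pin and
  -- `v₁` form no block.
  obtain ⟨a, k, l, d, ha, hl, hl', hcd, hau, hav⟩ : ∃ (a : crossSection n true) (k l : Fin n)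
      (d : Bool), IsPair a.1 k l ∧ l.val + 2 < n ∧ n ≤ l.val + 4 ∧ c = !d ∧
      a.1.partner (.inl u₀) = .inr (cond d v₁ u₁) ∧
      a.1.partner (.inl v₀) = .inr (cond d u₁ v₁) := by
    by_cases hij : ∃ t, IsBlock t i j
    · obtain ⟨a, ha⟩ := exists_isPair true (i := (⟨0, by omega⟩ : Fin n)) (j := v₁)
        (Fin.lt_def.2 (by simp only; omega))
      obtain ⟨d, ⟨-, hd⟩, hau, hav⟩ := ha.last_lines (by omega) h₀ h₁
      refine ⟨a, _, _, d, ha, by omega, by omega, ?_, hau, hav⟩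
      rw [hc hij, hd]
      · rfl
      · rintro ⟨t, h1, h2⟩
        simp only at h1
        omega
    · obtain ⟨a, ha⟩ := exists_isPair true (Fin.lt_def.2 h₁.val_lt)
      obtain ⟨d, ⟨hd, -⟩, hau, hav⟩ := ha.last_lines (by omega) h₀ h₁
      refine ⟨a, _, _, d, ha, by omega, by omega, ?_, hau, hav⟩
      rw [hc' hij, hd ⟨1, h₁⟩]
      rfl
  obtain ⟨z, y, x, hz, hy, hya, hx, hxa, hinc, hby, hay⟩ :=
    hall a ((isSecondLevel_iff (by omega) a).2 ⟨k, l, ha, hl, hl'⟩)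
  obtain ⟨s, t, hz⟩ := (isRightAtom_iff z).1 hz
  obtain ⟨f, g, hx⟩ := (isRightAtom_iff x).1 hx
  obtain ⟨p, q, hpq, hypq⟩ := (ne_crossSectionOne_iff y).1 hy
  have hpq' := Fin.lt_def.1 hpq
  rw [hx.isAbsorbed_iff, not_le] at hxa
  rw [isRightMultiple_iff] at hby hay
  have hn1 : 2 * 1 ≤ n := by omega
  have hcapy : cap 1 * y.1 = cap 1 :=
    congrArg Subtype.val (hya _ (crossSectionCap_ne_one hn1 le_rfl))
  -- An arc of `y` before the last pair would remain visible in `cap 1 * y = cap 1`.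
  have hq : n ≤ q.val + 2 := by
    by_contra hlt
    have h1 := cap_mul_pair_arc hypq hn1 hpq (by omega)
    rw [hcapy, cap_line 1 hn1 p (by omega)] at h1
    exact Sum.inr_ne_inl h1
  -- If the arc were the last pair, `y` would be `cap 1`. Its product with `x` would be a common
  -- right multiple of `y` and `x`, which is excluded.
  have hp : p.val + 2 < n := by
    by_contra hlt
    have hpu : p = u₀ := Fin.ext (by omega)
    have hqv : q = v₀ := Fin.ext (by omega)
    subst hpu hqv
    have hyc : y.1 = cap 1 := by
      have hlc : LeftCapped 1 y.1 :=
        LeftCapped.succ (k := 0) (fun t ht => by omega) h₀ hypq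
      rw [← hcapy, hlc.cap_mul hn1]
    refine hinc (crossSectionCap true hn1 * x) ⟨x, ?_⟩ ?_
    · exact Subtype.ext (by rw [crossSectionCap]; exact congrArg (· * x.1) hyc.symm)
    · rw [isRightMultiple_iff, hx.leftLE_iff]
      exact cap_mul_pair_arc hx.arc hn1 hx.lt (by omega)
  have hquv : q = u₀ ∨ q = v₀ := by
    have := q.isLt
    rcases Nat.lt_or_ge (q.val + 1) n with h | h
    · exact .inl (Fin.ext (by omega))
    · exact .inr (Fin.ext (by omega))
  have hone : ∀ {e : crossSection n true} {g h : Fin n}, IsPair e.1 g h → RightCapped 1 e.1 := by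
    intro e g h he
    obtain ⟨κ, hκ⟩ := exists_rightCapped e
    obtain rfl : κ = 1 := by have := hκ.corank; have := he.corank; omega
    exact hκ
  have hline : ∀ {e : crossSection n true} {g h : Fin n}, IsPair e.1 g h → h.val + 2 < n →
      LeftLE y.1 (e * z).1 → ∃ r, e.1.partner (.inl p) = .inr r := by
    intro e g h he hh hle
    rcases hr : e.1.partner (.inl p) with r | r
    · have h1 : (e * z).1.partner (.inl p) = .inl r := mul_left_arc z.1 hr
      rw [hle _ _ hypq, Sum.inl.injEq] at h1
      subst h1
      have := he.val_lt
      rcases he.eq_or_eq hr with ⟨rfl, rfl⟩ | ⟨rfl, rfl⟩ <;> omega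
    · exact ⟨r, rfl⟩
  obtain ⟨p₁, hp₁⟩ := hline ha hl hay
  obtain ⟨p₂, hp₂⟩ := hline hb hj hby
  have hinj : ∀ {r r' : Fin n}, a.1.partner (.inl r) = .inr r' → r' = p₁ → r = p := by
    rintro r r' hr rfl
    exact Sum.inl.inj (a.1.partner_injective (hr.trans hp₁.symm))
  have hne := h₁.ne
  rcases hquv with rfl | rfl
  -- Since the crossings are opposite, `b` sends `q` where `a` sends the other pin of the last pair.
  -- By `not_common_target` this is where `a` sends `p`, so `p` would lie in the last pair.
  · have := not_common_target hz (hone ha) (hone hb) (hay _ _ hypq) (hby _ _ hypq) hp₁ hau hp₂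
      hbu (by subst hcd; cases d <;> simp [hne, hne.symm])
    have := hinj hav (by rw [← this, hcd]; cases d <;> rfl)
    subst this; omega
  · have := not_common_target hz (hone ha) (hone hb) (hay _ _ hypq) (hby _ _ hypq) hp₁ hav hp₂
      hbv (by subst hcd; cases d <;> simp [hne, hne.symm])
    have := hinj hau (by rw [← this, hcd]; cases d <;> rfl)
    subst this; omega

theorem isEmpty_mulEquiv_crossSection (hn : 6 ≤ n) :
    IsEmpty (crossSection n false ≃* crossSection n true) := by
  refine ⟨fun φ => not_hasCommonTargets_crossSection_true hn ?_⟩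
  -- A multiplicative bijection preserves the identity, so the conditions relative to it are
  -- transported.
  have hone : φ (crossSectionOne n false) = crossSectionOne n true := by
    obtain ⟨x, hx⟩ := φ.surjective (crossSectionOne n true)
    have h1 : φ (crossSectionOne n false) * crossSectionOne n true =
        φ (crossSectionOne n false) := Subtype.ext (mul_one _)
    have h2 : crossSectionOne n false * x = x := Subtype.ext (one_mul _)
    rw [← h1, ← hx, ← map_mul, h2]
  rw [← hone, hasCommonTargets_map_iff]
  exact hasCommonTargets_crossSection_false hn

end Brauer

theorem theorem5 (n : ℕ) (hn : 6 ≤ n) :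
    (∃! Λ : Subsemigroup (Brauer n), Brauer.IsRegular Λ) ∧
    (∃! Γ : Subsemigroup (Brauer n), Brauer.IsAlternating Γ) ∧
    ∀ Λ Γ : Subsemigroup (Brauer n), Brauer.IsRegular Λ → Brauer.IsAlternating Γ →
      IsEmpty (Λ ≃* Γ) := by
  simp only [Brauer.isRegular_iff_eq, Brauer.isAlternating_iff_eq, existsUnique_eq, true_and]
  rintro Λ Γ rfl rfl
  exact Brauer.isEmpty_mulEquiv_crossSection hn
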